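/- Consider the heteroscedastic linear model $Y=\mu^*+X^\top\beta^*+\sigma(X)\varepsilon$ with $\mu^*\in\mathbb R$, $\beta^*\in\mathbb R^d$, and let $Y_i=\mu^*+X_i^\top\beta^*+\sigma(X_i)\varepsilon_i$, $i=1,\dots,n$ ($n\ge 1$), where the pairs $(Y_i,X_i)$ are independent copies of $(Y,X)$. Assume: (i) the random vector $X\in\mathbb R^d$ satisfies $E X=0$, $E(XX^\top)=\Sigma$ is positive definite, and $\|\Sigma^{-1/2}X\|_{\psi_2}<\infty$, where $\|Z\|_{\psi_2}=\sup_{\|u\|=1}\sup_{p\ge1}p^{-1/2}(E|u^\top Z|^p)^{1/p}$; (ii) $\varepsilon$ is independent of $X$, with $E\varepsilon=0$ and $E\varepsilon^2=1$; (iii) $\sigma(\cdot):\mathbb R^d\to(0,\infty)$ is measurable and $\sigma^2:=E\{\sigma^2(X)\}<\infty$, with $\sigma>0$. Put $\nu=\sigma(X)\varepsilon$, $\nu_i=\sigma(X_i)\varepsilon_i$ and $v_\kappa=E|\nu|^\kappa$. For $\tau>0$ let $\ell_\tau$ be the Huber loss, $\ell_\tau(u)=u^2/2$ if $|u|\le\tau$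 and $\ell_\tau(u)=\tau|u|-\tau^2/2$ if $|u|>\tau$, and let $W_n=n^{-1/2}\sum_{i=1}^n\ell_\tau'(\nu_i)$. Let $\Phi$ be the standard normal distribution function. There is an absolute constant $C>0$ such that the following hold for every such model, every $n\ge1$ and every $\tau>0$. If $v_\kappa<\infty$ for some real $\kappa\ge3$, then $$\sup_{x\in\mathbb R}|P(\sigma^{-1}W_n\le x)-\Phi(x)|\le C\big(\sigma^{-3}v_3n^{-1/2}+\sigma^{-2}v_\kappa\tau^{2-\kappa}+\sigma^2\tau^{-2}+\sigma^{-1}v_\kappa\tau^{1-\kappa}\sqrt n\big).$$ In particular, if $v_4<\infty$, then $$\sup_{x\in\mathbb R}|P(\sigma^{-1}W_n\le x)-\Phi(x)|\le C\big(\sigma^{-3}v_3n^{-1/2}+\sigma^{-2}v_4\tau^{-2}+\sigma^{-1}v_4\tau^{-3}\sqrt n\big).$$ -/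

import Mathlib

open MeasureTheory ProbabilityTheory
open scoped ENNReal MatrixOrder

noncomputable section

/-- The Huber loss `ℓ_τ(u)`: `u² / 2` for `|u| ≤ τ` and `τ |u| - τ² / 2` for `|u| > τ`. -/
def huberLoss (τ u : ℝ) : ℝ :=
  if |u| ≤ τ then u ^ 2 / 2 else τ * |u| - τ ^ 2 / 2

/-- The sub-Gaussian norm `sup_{p ≥ 1} p^{-1/2} (E |Z|^p)^{1/p}` of a real random variable `Z`,
as an extended nonnegative number. -/
def subGaussianNorm {Ω : Type*} [MeasurableSpace Ω] (P : Measure Ω) (Z : Ω → ℝ) : ℝ≥0∞ :=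
  ⨆ (p : ℝ) (_ : 1 ≤ p), ENNReal.ofReal (p ^ (-(1 / 2) : ℝ)) * eLpNorm Z (ENNReal.ofReal p) P

/-- The sub-Gaussian norm of a random vector `Z`: the supremum over unit vectors `u` of the
sub-Gaussian norms of the one-dimensional marginals `⟨u, Z⟩`. -/
def vectorSubGaussianNorm {Ω : Type*} [MeasurableSpace Ω] (P : Measure Ω) {d : ℕ}
    (Z : Ω → EuclideanSpace ℝ (Fin d)) : ℝ≥0∞ :=
  ⨆ (u : EuclideanSpace ℝ (Fin d)) (_ : ‖u‖ = 1), subGaussianNorm P (fun ω => inner ℝ u (Z ω))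

/-- The second moment matrix `E (X Xᵀ)`. -/
def secondMomentMatrix {Ω : Type*} [MeasurableSpace Ω] (P : Measure Ω) {d : ℕ}
    (X : Ω → EuclideanSpace ℝ (Fin d)) : Matrix (Fin d) (Fin d) ℝ :=
  Matrix.of fun j k => ∫ ω, X ω j * X ω k ∂P

/-- The standardized vector `Σ^{-1/2} X`, where `Σ = E (X Xᵀ)`. The matrix `Σ^{-1/2}` is the
positive semidefinite square root of `Σ⁻¹`. -/
def standardized {Ω : Type*} [MeasurableSpace Ω] (P : Measure Ω) {d : ℕ}
    (X : Ω → EuclideanSpace ℝ (Fin d)) (ω : Ω) : EuclideanSpace ℝ (Fin d) :=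
  WithLp.toLp 2 (Matrix.mulVec (CFC.sqrt (secondMomentMatrix P X)⁻¹) (X ω).ofLp)

/-- The assumptions on the covariate vector `X`, the error `ε` and the variance function `s`
(the function `σ(·)`) of the heteroscedastic linear model. -/
structure ModelCondition {Ω : Type*} [MeasurableSpace Ω] (P : Measure Ω) {d : ℕ}
    (X : Ω → EuclideanSpace ℝ (Fin d)) (ε : Ω → ℝ) (s : EuclideanSpace ℝ (Fin d) → ℝ) :
    Prop where
  /-- All entries of `E (X Xᵀ)` exist. -/
  memLp_X : MemLp X 2 P
  mean_X : ∫ ω, X ω ∂P = 0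
  posDef : (secondMomentMatrix P X).PosDef
  subGaussian : vectorSubGaussianNorm P (standardized P X) < ∞
  indep : IndepFun ε X P
  memLp_ε : MemLp ε 2 P
  mean_ε : ∫ ω, ε ω ∂P = 0
  var_ε : ∫ ω, ε ω ^ 2 ∂P = 1
  measurable_s : Measurable s
  pos_s : ∀ x, 0 < s x
  integrable_s : Integrable (fun ω => s (X ω) ^ 2) P

/-- The response `μ + Xᵀ β + s(X) ε` of the heteroscedastic linear model. -/
def response {Ω : Type*} {d : ℕ} (μ : ℝ) (β : EuclideanSpace ℝ (Fin d))
    (s : EuclideanSpace ℝ (Fin d) → ℝ) (X : Ω → EuclideanSpace ℝ (Fin d)) (ε : Ω → ℝ)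
    (ω : Ω) : ℝ :=
  μ + inner ℝ (X ω) β + s (X ω) * ε ω

/-- The pairs `(Y_i, X_i)`, where `Y_i` is the response to covariate `X_i` with error `ε_i`,
are independent copies of the pair `(Y, X)`, where `Y` is the response to `X` with error `ε`. -/
structure IsModelSample {Ω : Type*} [MeasurableSpace Ω] (P : Measure Ω) {d n : ℕ}
    (μ : ℝ) (β : EuclideanSpace ℝ (Fin d)) (s : EuclideanSpace ℝ (Fin d) → ℝ)
    (X : Ω → EuclideanSpace ℝ (Fin d)) (ε : Ω → ℝ)
    (Xs : Fin n → Ω → EuclideanSpace ℝ (Fin d)) (εs : Fin n → Ω → ℝ) : Prop where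
  indep : iIndepFun (fun i ω => (response μ β s (Xs i) (εs i) ω, Xs i ω)) P
  ident : ∀ i, IdentDistrib (fun ω => (response μ β s (Xs i) (εs i) ω, Xs i ω))
    (fun ω => (response μ β s X ε ω, X ω)) P P

/-- The regression noise `ν = s(X) ε`. -/
def noise {Ω : Type*} {d : ℕ} (s : EuclideanSpace ℝ (Fin d) → ℝ)
    (X : Ω → EuclideanSpace ℝ (Fin d)) (ε : Ω → ℝ) (ω : Ω) : ℝ :=
  s (X ω) * ε ω

/-- The number `σ > 0` with `σ² = E s(X)²`. -/
def noiseScale {Ω : Type*} [MeasurableSpace Ω] (P : Measure Ω) {d : ℕ}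
    (s : EuclideanSpace ℝ (Fin d) → ℝ) (X : Ω → EuclideanSpace ℝ (Fin d)) : ℝ :=
  Real.sqrt (∫ ω, s (X ω) ^ 2 ∂P)

/-- The absolute moment `v_κ = E |ν|^κ`. -/
def absMoment {Ω : Type*} [MeasurableSpace Ω] (P : Measure Ω) (ν : Ω → ℝ) (κ : ℝ) : ℝ :=
  ∫ ω, |ν ω| ^ κ ∂P

/-- The statistic `W_n = n^{-1/2} ∑ ℓ'_τ(ν_i)`, with `ℓ'_τ` the derivative of the Huber loss. -/
def scoreSum {Ω : Type*} {n : ℕ} (τ : ℝ) (νs : Fin n → Ω → ℝ) (ω : Ω) : ℝ :=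
  (n : ℝ) ^ (-(1 / 2) : ℝ) * ∑ i, deriv (huberLoss τ) (νs i ω)

/-- The Kolmogorov distance `sup_x |P(T ≤ x) - Φ(x)|` of `T` from the standard normal law. -/
def distToNormal {Ω : Type*} [MeasurableSpace Ω] (P : Measure Ω) (T : Ω → ℝ) : ℝ :=
  ⨆ x : ℝ, |P.real {ω | T ω ≤ x} - cdf (gaussianReal 0 1) x|

end

/-!
The Huber score `ℓ_τ'` is the truncation `clip τ` to `[-τ, τ]`, so `W_n` is a normalised sum of
independent bounded variables `clip τ ν_i`. Truncation costs little: since `E ν = 0` and the tails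
of `ν` are controlled by `v_κ`, the mean `m` of `clip τ ν` is at most `v_κ τ^(1 - κ)` in absolute
value and its variance `s²` lies between `σ² - 2 v_κ τ^(2 - κ)` and `σ²`. Unless `v_κ τ^(2 - κ)` is
comparable to `σ²`, in which case the claimed bound exceeds one, `s` is comparable to `σ`, and the
Berry–Esseen theorem for the standardised variables `(clip τ ν_i - m) / s` gives the term
`σ⁻³ v₃ n^(-1/2)`. Undoing the standardisation shifts the argument of `Φ` by `√n m / s` and dilates
it by `σ / s`, which produces the two other terms
(`exists_abs_measureReal_sum_clip_le_sub_cdf_le`). The term `σ² τ⁻²` is not needed, so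
both claims follow from one bound.

The Berry–Esseen theorem (`exists_abs_measureReal_sum_le_sub_cdf_le`) is proved with characteristic
functions. The Fejér kernel is nonnegative and has a Fourier transform supported in `[-1, 1]`.
Averaging the difference of two distribution functions against it therefore only sees their
characteristic functions on `[-1, 1]` (`abs_integral_cdf_sub_mul_fejer_le`), and because
one of the distribution functions is Lipschitz and the other one monotone, the averages control the
supremum (`exists_abs_cdf_sub_le`, Esseen's smoothing inequality). It is applied to the normalised
sum and to the normal law, both scaled by `T = √n / (16 ρ)` with `ρ` the third absolute moment: in
the resulting range of frequencies a Taylor expansion bounds the difference of the characteristic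
functions by a Gaussian (`norm_charFun_pow_sub_exp_le`).
-/

namespace BerryEsseen

open Set Filter Topology

/-! ### The Fejér kernel -/

/-- The Fejér kernel `sinc² (x / 2) = 2 (1 - cos x) / x²`, up to the factor `2π` the density whose
Fourier transform is the triangle function `(1 - |t|)₊`. It is not normalised to integral one. -/
noncomputable def fejer (x : ℝ) : ℝ := Real.sinc (x / 2) ^ 2

lemma continuous_fejer : Continuous fejer := by
  unfold fejer
  exact (Real.continuous_sinc.comp (continuous_id.div_const 2)).pow 2

lemma fejer_nonneg (x : ℝ) : 0 ≤ fejer x := sq_nonneg _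

lemma fejer_neg (x : ℝ) : fejer (-x) = fejer x := by
  simp [fejer, neg_div]

lemma fejer_of_ne_zero {x : ℝ} (hx : x ≠ 0) : fejer x = 2 * (1 - Real.cos x) / x ^ 2 := by
  have h : Real.cos x = 1 - 2 * Real.sin (x / 2) ^ 2 := by
    have := Real.cos_two_mul (x / 2)
    rw [show 2 * (x / 2) = x by ring] at this
    rw [this, Real.cos_sq']; ring
  rw [fejer, Real.sinc_of_ne_zero (by simpa using hx), h]
  field_simp
  ring

lemma fejer_le_inv_one_add_sq (x : ℝ) : fejer x ≤ 8 * (1 + x ^ 2)⁻¹ := by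
  rw [← div_eq_mul_inv, le_div_iff₀ (by positivity)]
  have h1 : fejer x ≤ 1 := by
    have := Real.abs_sinc_le_one (x / 2)
    rw [fejer, ← sq_abs]
    exact pow_le_one₀ (abs_nonneg _) this
  have h2 : fejer x * x ^ 2 ≤ 4 := by
    rcases eq_or_ne x 0 with rfl | hx
    · simp
    · rw [fejer_of_ne_zero hx, div_mul_cancel₀ _ (by positivity)]
      linarith [Real.neg_one_le_cos x]
  linarith

lemma integrable_fejer : Integrable fejer := by
  refine Integrable.mono' (integrable_inv_one_add_sq.const_mul 8)
    continuous_fejer.aestronglyMeasurable (ae_of_all _ fun x => ?_)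
  rw [Real.norm_of_nonneg (fejer_nonneg x)]
  exact fejer_le_inv_one_add_sq x

lemma integral_fejer_pos : 0 < ∫ x, fejer x :=
  integral_pos_of_integrable_nonneg_nonzero (x := 0) continuous_fejer integrable_fejer
    fejer_nonneg (by simp [fejer])

lemma fejer_eq_integral_cos {x : ℝ} (hx : x ≠ 0) :
    fejer x = ∫ t in (0 : ℝ)..1, 2 * (1 - t) * Real.cos (t * x) := by
  have hd : ∀ t ∈ uIcc (0 : ℝ) 1, HasDerivAt
      (fun t => 2 * (1 - t) * (Real.sin (t * x) / x) - 2 * Real.cos (t * x) / x ^ 2)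
      (2 * (1 - t) * Real.cos (t * x)) t := by
    intro t _
    have hl : HasDerivAt (fun t : ℝ => t * x) x t := by
      simpa using (hasDerivAt_id t).mul_const x
    have h1 := (((hasDerivAt_id t).const_sub 1).const_mul 2).mul (hl.sin.div_const x)
    have h2 := (hl.cos.const_mul 2).div_const (x ^ 2)
    refine (h1.sub h2).congr_deriv ?_
    simp only [id]
    field_simp
    ring
  rw [intervalIntegral.integral_eq_sub_of_hasDerivAt hd
    (Continuous.intervalIntegrable (by fun_prop) _ _), fejer_of_ne_zero hx]
  simp
  ring

/-! ### Esseen's smoothing inequality -/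

/-- The `t`-frequency contribution to the mass that the Fejér kernel centred at `w` gives to
`(a, b]`; it vanishes at `t = 0` by the convention `x / 0 = 0`. -/
noncomputable def fejerMode (a b t w : ℝ) : ℝ :=
  2 * (1 - t) / t * (Real.sin (t * (b - w)) - Real.sin (t * (a - w)))

lemma abs_fejerMode_le {a b t : ℝ} (w : ℝ) (hab : a ≤ b) (ht : t ∈ Ioc (0 : ℝ) 1) :
    |fejerMode a b t w| ≤ 2 * (b - a) := by
  have hs : |Real.sin (t * (b - w)) - Real.sin (t * (a - w))| ≤ t * (b - a) := by
    have := Real.lipschitzWith_sin.dist_le_mul (t * (b - w)) (t * (a - w))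
    rw [Real.dist_eq, Real.dist_eq] at this
    refine this.trans (le_of_eq ?_)
    rw [show t * (b - w) - t * (a - w) = t * (b - a) by ring,
      abs_of_nonneg (mul_nonneg ht.1.le (by linarith))]
    simp
  have h0 : 0 ≤ 2 * (1 - t) / t := div_nonneg (by linarith [ht.2]) ht.1.le
  rw [fejerMode, abs_mul, abs_of_nonneg h0]
  calc _ ≤ 2 * (1 - t) / t * (t * (b - a)) := by gcongr
    _ = 2 * (1 - t) * (b - a) := by field_simp [ht.1.ne']
    _ ≤ 2 * (b - a) := by nlinarith [ht.1]

lemma measurable_fejerMode (a b : ℝ) : Measurable (fun p : ℝ × ℝ => fejerMode a b p.1 p.2) := by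
  unfold fejerMode
  fun_prop

lemma integral_fejer_sub {a b : ℝ} (hab : a ≤ b) (w : ℝ) :
    ∫ x in Ioc a b, fejer (x - w) = ∫ t in (0 : ℝ)..1, fejerMode a b t w := by
  have : IsFiniteMeasure (volume.restrict (uIoc (0 : ℝ) 1)) :=
    inferInstanceAs (IsFiniteMeasure (volume.restrict (Ioc (min (0 : ℝ) 1) (max 0 1))))
  have hint : Integrable (Function.uncurry fun t x : ℝ => 2 * (1 - t) * Real.cos (t * (x - w)))
      ((volume.restrict (uIoc (0 : ℝ) 1)).prod (volume.restrict (Ioc a b))) := by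
    refine Integrable.of_bound (C := 2)
      (Continuous.aestronglyMeasurable (by unfold Function.uncurry; fun_prop)) ?_
    rw [Measure.prod_restrict]
    refine (ae_restrict_iff' (measurableSet_uIoc.prod measurableSet_Ioc)).2 (ae_of_all _ ?_)
    · rintro ⟨t, x⟩ ⟨ht, -⟩
      rw [uIoc_of_le zero_le_one] at ht
      have h0 : 0 ≤ 2 * (1 - t) := by linarith [ht.2]
      have := Real.abs_cos_le_one (t * (x - w))
      simp only [Function.uncurry, Real.norm_eq_abs, abs_mul]
      rw [← abs_mul 2, abs_of_nonneg h0]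
      nlinarith [ht.1]
  calc ∫ x in Ioc a b, fejer (x - w)
      = ∫ x in Ioc a b, ∫ t in (0 : ℝ)..1, 2 * (1 - t) * Real.cos (t * (x - w)) := by
        refine integral_congr_ae (ae_restrict_of_ae ?_)
        filter_upwards [Measure.ae_ne volume w] with x hx
        exact fejer_eq_integral_cos (sub_ne_zero.2 hx)
    _ = ∫ t in (0 : ℝ)..1, ∫ x in Ioc a b, 2 * (1 - t) * Real.cos (t * (x - w)) :=
        (intervalIntegral_integral_swap hint).symm
    _ = ∫ t in (0 : ℝ)..1, fejerMode a b t w := by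
        refine intervalIntegral.integral_congr_ae (ae_of_all _ fun t ht => ?_)
        rw [uIoc_of_le zero_le_one] at ht
        have ht0 := ht.1.ne'
        rw [← intervalIntegral.integral_of_le hab,
          intervalIntegral.integral_eq_sub_of_hasDerivAt
            (f := fun x => 2 * (1 - t) / t * Real.sin (t * (x - w))) _
            (Continuous.intervalIntegrable (by fun_prop) _ _)]
        · simp only [fejerMode]; ring
        · intro x _
          have hl : HasDerivAt (fun x : ℝ => t * (x - w)) t x := by
            simpa using ((hasDerivAt_id x).sub_const w).const_mul t
          refine (hl.sin.const_mul (2 * (1 - t) / t)).congr_deriv ?_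
          field_simp

lemma abs_integral_sin_sub_le (μ ν : Measure ℝ) [IsProbabilityMeasure μ] [IsProbabilityMeasure ν]
    (t x : ℝ) :
    |∫ w, Real.sin (t * (x - w)) ∂μ - ∫ w, Real.sin (t * (x - w)) ∂ν| ≤
      ‖charFun μ t - charFun ν t‖ := by
  have key : ∀ (ρ : Measure ℝ) [IsProbabilityMeasure ρ], ∫ w, Real.sin (t * (x - w)) ∂ρ
      = -(Complex.exp ((-(t * x) : ℝ) * Complex.I) * charFun ρ t).im := by
    intro ρ _
    have hi : Integrable (fun w : ℝ => Complex.exp (((t * (w - x) : ℝ) : ℂ) * Complex.I)) ρ := by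
      refine Integrable.of_bound (C := 1) (Continuous.aestronglyMeasurable (by fun_prop)) ?_
      exact ae_of_all _ fun w => (Complex.norm_exp_ofReal_mul_I _).le
    have h1 : Complex.exp ((-(t * x) : ℝ) * Complex.I) * charFun ρ t
        = ∫ w, Complex.exp (((t * (w - x) : ℝ) : ℂ) * Complex.I) ∂ρ := by
      rw [charFun_apply_real, ← integral_const_mul]
      congr 1 with w
      rw [← Complex.exp_add]
      congr 1
      push_cast
      ring
    have h2 := integral_im hi
    rw [h1]
    simp only [RCLike.im_to_complex] at h2
    rw [← h2, ← integral_neg]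
    congr 1 with w
    rw [Complex.exp_ofReal_mul_I_im, ← Real.sin_neg]
    congr 1
    ring
  rw [key μ, key ν]
  have : -(Complex.exp ((-(t * x) : ℝ) * Complex.I) * charFun μ t).im
      - -(Complex.exp ((-(t * x) : ℝ) * Complex.I) * charFun ν t).im
      = -(Complex.exp ((-(t * x) : ℝ) * Complex.I) * (charFun μ t - charFun ν t)).im := by
    rw [mul_sub, Complex.sub_im]; ring
  rw [this, abs_neg]
  refine (Complex.abs_im_le_norm _).trans ?_
  rw [norm_mul, Complex.norm_exp_ofReal_mul_I, one_mul]

/-- The mass that `μ`, smoothed by the Fejér kernel, gives to `(a, b]`, decomposed into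
frequencies. -/
lemma integral_measureReal_Ioc_mul_fejer (μ : Measure ℝ) [IsProbabilityMeasure μ] {a b : ℝ}
    (hab : a ≤ b) :
    ∫ u, μ.real (Ioc (a - u) (b - u)) * fejer u = ∫ t in (0 : ℝ)..1, ∫ w, fejerMode a b t w ∂μ := by
  set S : Set (ℝ × ℝ) := {p | a < p.1 + p.2 ∧ p.1 + p.2 ≤ b} with hS
  have hSm : MeasurableSet S :=
    (measurableSet_lt measurable_const (measurable_fst.add measurable_snd)).inter
      (measurableSet_le (measurable_fst.add measurable_snd) measurable_const)
  have hint : Integrable (Function.uncurry fun u w : ℝ => S.indicator (fun p => fejer p.1) (u, w))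
      (volume.prod μ) := by
    have : Integrable (fun p : ℝ × ℝ => fejer p.1) (volume.prod μ) := by
      simpa using integrable_fejer.mul_prod (integrable_const (1 : ℝ)) (ν := μ)
    exact this.indicator hSm
  have : IsFiniteMeasure (volume.restrict (uIoc (0 : ℝ) 1)) :=
    inferInstanceAs (IsFiniteMeasure (volume.restrict (Ioc (min (0 : ℝ) 1) (max 0 1))))
  have hint2 : Integrable (Function.uncurry fun t w : ℝ => fejerMode a b t w)
      ((volume.restrict (uIoc (0 : ℝ) 1)).prod μ) := by
    refine Integrable.of_bound (C := 2 * (b - a))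
      (measurable_fejerMode a b).aestronglyMeasurable ?_
    have : (volume.restrict (uIoc (0 : ℝ) 1)).prod μ
        = (volume.prod μ).restrict (uIoc (0 : ℝ) 1 ×ˢ univ) := by
      rw [← Measure.prod_restrict, Measure.restrict_univ]
    rw [this]
    refine (ae_restrict_iff' (measurableSet_uIoc.prod MeasurableSet.univ)).2 (ae_of_all _ ?_)
    rintro ⟨t, w⟩ ⟨ht, -⟩
    rw [uIoc_of_le zero_le_one] at ht
    exact abs_fejerMode_le w hab ht
  calc ∫ u, μ.real (Ioc (a - u) (b - u)) * fejer u
      = ∫ u, ∫ w, S.indicator (fun p => fejer p.1) (u, w) ∂μ := by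
        congr 1 with u
        have : (fun w => S.indicator (fun p : ℝ × ℝ => fejer p.1) (u, w))
            = (Ioc (a - u) (b - u)).indicator (fun _ => fejer u) := by
          ext w
          simp only [indicator_apply, hS, mem_ofPred_eq, mem_Ioc, sub_lt_iff_lt_add',
            le_sub_iff_add_le']
        rw [this, integral_indicator_const _ measurableSet_Ioc, smul_eq_mul]
    _ = ∫ w, (∫ u, S.indicator (fun p => fejer p.1) (u, w)) ∂μ := integral_integral_swap hint
    _ = ∫ w, (∫ x in Ioc a b, fejer (x - w)) ∂μ := by
        congr 1 with w
        rw [← integral_sub_right_eq_self _ w, ← integral_indicator measurableSet_Ioc]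
        congr 1 with x
        simp [indicator_apply, hS]
    _ = ∫ w, (∫ t in (0 : ℝ)..1, fejerMode a b t w) ∂μ := by
        simp_rw [integral_fejer_sub hab]
    _ = _ := (intervalIntegral_integral_swap hint2).symm

lemma abs_integral_measureReal_Ioc_sub_le (μ ν : Measure ℝ) [IsProbabilityMeasure μ]
    [IsProbabilityMeasure ν] {ψ : ℝ → ℝ} (hψ : IntervalIntegrable ψ volume 0 1)
    (h : ∀ t ∈ Ioc (0 : ℝ) 1, ‖charFun μ t - charFun ν t‖ ≤ t * ψ t) {a b : ℝ} (hab : a ≤ b) :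
    |(∫ u, μ.real (Ioc (a - u) (b - u)) * fejer u) -
      ∫ u, ν.real (Ioc (a - u) (b - u)) * fejer u|
      ≤ 4 * ∫ t in (0 : ℝ)..1, ψ t := by
  have hsin : ∀ (ρ : Measure ℝ) [IsProbabilityMeasure ρ] (t x : ℝ),
      Integrable (fun w => Real.sin (t * (x - w))) ρ := fun ρ _ t x =>
    Integrable.of_bound (C := 1) (Continuous.aestronglyMeasurable (by fun_prop))
      (ae_of_all _ fun w => Real.abs_sin_le_one _)
  have hmode : ∀ (ρ : Measure ℝ) [IsProbabilityMeasure ρ],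
      IntervalIntegrable (fun t => ∫ w, fejerMode a b t w ∂ρ) volume 0 1 := by
    intro ρ _
    rw [intervalIntegrable_iff_integrableOn_Ioc_of_le zero_le_one]
    refine Integrable.of_bound (C := 2 * (b - a)) ?_ ?_
    · exact (measurable_fejerMode a b).stronglyMeasurable.integral_prod_right'.aestronglyMeasurable
    · refine (ae_restrict_iff' measurableSet_Ioc).2 (ae_of_all _ fun t ht => ?_)
      refine (norm_integral_le_of_norm_le_const (ae_of_all _ fun w =>
        abs_fejerMode_le w hab ht)).trans (by simp)
  rw [integral_measureReal_Ioc_mul_fejer μ hab, integral_measureReal_Ioc_mul_fejer ν hab,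
    ← intervalIntegral.integral_sub (hmode μ) (hmode ν), ← intervalIntegral.integral_const_mul,
    ← Real.norm_eq_abs]
  refine intervalIntegral.norm_integral_le_of_norm_le zero_le_one (ae_of_all _ fun t ht => ?_)
    (hψ.const_mul 4)
  have hrw : ∀ (ρ : Measure ℝ) [IsProbabilityMeasure ρ], ∫ w, fejerMode a b t w ∂ρ
      = 2 * (1 - t) / t *
        (∫ w, Real.sin (t * (b - w)) ∂ρ - ∫ w, Real.sin (t * (a - w)) ∂ρ) := by
    intro ρ _
    simp only [fejerMode]
    rw [integral_const_mul, integral_sub (hsin ρ t b) (hsin ρ t a)]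
  have h0 : 0 ≤ 2 * (1 - t) / t := div_nonneg (by linarith [ht.2]) ht.1.le
  have hψ0 : 0 ≤ ψ t := by
    by_contra! hc
    nlinarith [h t ht, norm_nonneg (charFun μ t - charFun ν t), ht.1]
  rw [hrw μ, hrw ν, ← mul_sub, Real.norm_eq_abs, abs_mul, abs_of_nonneg h0]
  have hb := (abs_integral_sin_sub_le μ ν t b).trans (h t ht)
  have ha := (abs_integral_sin_sub_le μ ν t a).trans (h t ht)
  calc _ ≤ 2 * (1 - t) / t * (t * ψ t + t * ψ t) := by
        gcongr
        rw [abs_le] at ha hb ⊢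
        constructor <;> linarith [ha.1, ha.2, hb.1, hb.2]
    _ = 4 * ((1 - t) * ψ t) := by field_simp [ht.1.ne']; ring
    _ ≤ 4 * ψ t := by nlinarith [ht.1]

lemma measureReal_Ioc_eq_cdf_sub (μ : Measure ℝ) [IsProbabilityMeasure μ] {a b : ℝ}
    (hab : a ≤ b) : μ.real (Ioc a b) = cdf μ b - cdf μ a := by
  rw [cdf_eq_real, cdf_eq_real, ← Iic_sdiff_Iic, measureReal_sdiff (Iic_subset_Iic.2 hab)
    measurableSet_Iic]

/-- The Fejér average of the difference of two distribution functions is controlled by their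
characteristic functions on `(0, 1]` only, the Fourier transform of the kernel being supported
in `[-1, 1]`. -/
lemma abs_integral_cdf_sub_mul_fejer_le (μ ν : Measure ℝ) [IsProbabilityMeasure μ]
    [IsProbabilityMeasure ν] {ψ : ℝ → ℝ} (hψ : IntervalIntegrable ψ volume 0 1)
    (h : ∀ t ∈ Ioc (0 : ℝ) 1, ‖charFun μ t - charFun ν t‖ ≤ t * ψ t) (b : ℝ) :
    |∫ u, (cdf μ (b - u) - cdf ν (b - u)) * fejer u| ≤ 4 * ∫ t in (0 : ℝ)..1, ψ t := by
  have hmeas : ∀ (ρ : Measure ℝ) (c : ℝ), Measurable fun u => cdf ρ (c - u) := fun ρ c =>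
    (monotone_cdf ρ).measurable.comp (measurable_const.sub measurable_id)
  have hint : ∀ (ρ : Measure ℝ) (c : ℝ), Integrable fun u => cdf ρ (c - u) * fejer u := by
    intro ρ c
    refine integrable_fejer.mono' ((hmeas ρ c).aestronglyMeasurable.mul
      continuous_fejer.aestronglyMeasurable) (ae_of_all _ fun u => ?_)
    rw [Real.norm_eq_abs, abs_mul, abs_of_nonneg (cdf_nonneg ρ _), abs_of_nonneg (fejer_nonneg u)]
    exact mul_le_of_le_one_left (fejer_nonneg u) (cdf_le_one ρ _)
  -- the part of the integral coming from the left end point vanishes as it moves to `-∞`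
  have hlim : Tendsto (fun a : ℝ => ∫ u, (cdf μ (a - u) - cdf ν (a - u)) * fejer u) atBot
      (𝓝 0) := by
    have : Tendsto (fun a : ℝ => ∫ u, (cdf μ (a - u) - cdf ν (a - u)) * fejer u) atBot
        (𝓝 (∫ _ : ℝ, (0 : ℝ))) := by
      refine tendsto_integral_filter_of_dominated_convergence fejer
        (Eventually.of_forall fun a => ?_) (Eventually.of_forall fun a => ae_of_all _ fun u => ?_)
        integrable_fejer (ae_of_all _ fun u => ?_)
      · exact ((hmeas μ a).sub (hmeas ν a)).aestronglyMeasurable.mul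
          continuous_fejer.aestronglyMeasurable
      · rw [Real.norm_eq_abs, abs_mul, abs_of_nonneg (fejer_nonneg u)]
        refine mul_le_of_le_one_left (fejer_nonneg u) (abs_le.2 ⟨?_, ?_⟩) <;>
        linarith [cdf_nonneg μ (a - u), cdf_le_one μ (a - u), cdf_nonneg ν (a - u),
          cdf_le_one ν (a - u)]
      · have hsub : Tendsto (fun a : ℝ => a - u) atBot atBot :=
          tendsto_atBot_add_const_right _ (-u) tendsto_id
        simpa using (((tendsto_cdf_atBot μ).comp hsub).sub
          ((tendsto_cdf_atBot ν).comp hsub)).mul_const (fejer u)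
    simpa using this
  have hle : ∀ᶠ a in atBot, |(∫ u, (cdf μ (b - u) - cdf ν (b - u)) * fejer u)
      - ∫ u, (cdf μ (a - u) - cdf ν (a - u)) * fejer u| ≤ 4 * ∫ t in (0 : ℝ)..1, ψ t := by
    filter_upwards [eventually_le_atBot b] with a hab
    have hJ := abs_integral_measureReal_Ioc_sub_le μ ν hψ h hab
    have hrw : ∀ (ρ : Measure ℝ) [IsProbabilityMeasure ρ],
        ∫ u, ρ.real (Ioc (a - u) (b - u)) * fejer u
          = (∫ u, cdf ρ (b - u) * fejer u) - ∫ u, cdf ρ (a - u) * fejer u := by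
      intro ρ _
      rw [← integral_sub (hint ρ b) (hint ρ a)]
      congr 1 with u
      rw [measureReal_Ioc_eq_cdf_sub ρ (by linarith)]
      ring
    rw [hrw μ, hrw ν] at hJ
    simp_rw [sub_mul]
    rw [integral_sub (hint μ b) (hint ν b), integral_sub (hint μ a) (hint ν a)]
    refine le_of_eq_of_le (congrArg _ ?_) hJ
    ring
  have hlim2 : Tendsto (fun a : ℝ => |(∫ u, (cdf μ (b - u) - cdf ν (b - u)) * fejer u)
      - ∫ u, (cdf μ (a - u) - cdf ν (a - u)) * fejer u|) atBot
      (𝓝 |∫ u, (cdf μ (b - u) - cdf ν (b - u)) * fejer u|) := by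
    simpa using (tendsto_const_nhds.sub hlim).abs
  exact le_of_tendsto hlim2 hle

/-- A bounded function that decreases at most at rate `K` cannot take a positive value close to its
supremum without its Fejér averages being large: just to the right of such a point it stays
large over the bulk of the kernel. -/
lemma mul_integral_fejer_le_of_average_le {g : ℝ → ℝ} {K D M L x : ℝ}
    (hL' : 3 / 4 * (∫ u, fejer u) ≤ ∫ u in Ioc (-L) L, fejer u) (hK : 0 ≤ K) (hM0 : 0 ≤ M)
    (hg : ∀ y z, y ≤ z → g y - K * (z - y) ≤ g z) (hD : ∀ y, |g y| ≤ D)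
    (hgm : Measurable g) (hM : ∫ u, g (x + L - u) * fejer u ≤ M) :
    (3 * g x - D - 6 * L * K) * (∫ u, fejer u) ≤ 4 * M := by
  have hc := integral_fejer_pos
  have hD0 : 0 ≤ D := (abs_nonneg _).trans (hD 0)
  set e := g x - 2 * L * K with he
  rcases le_or_gt e 0 with hneg | hpos
  · have : 3 * g x - D - 6 * L * K ≤ 0 := by linarith
    nlinarith
  · have hint0 : Integrable fun u => g (x + L - u) * fejer u :=
      integrable_fejer.bdd_mul (c := D)
        (hgm.comp (measurable_const.sub measurable_id)).aestronglyMeasurable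
        (ae_of_all _ fun u => hD _)
    have hint1 : Integrable ((Ioc (-L) L).indicator fun u => (e + D) * fejer u) :=
      (integrable_fejer.const_mul _).indicator measurableSet_Ioc
    have hint2 : Integrable fun u => D * fejer u := integrable_fejer.const_mul _
    have hle : ∫ u, ((Ioc (-L) L).indicator (fun u => (e + D) * fejer u) u - D * fejer u)
        ≤ ∫ u, g (x + L - u) * fejer u := by
      refine integral_mono (hint1.sub hint2) hint0 fun u => ?_
      have hf := fejer_nonneg u
      have hlow := neg_le_of_abs_le (hD (x + L - u))
      by_cases hu : u ∈ Ioc (-L) L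
      · have h1 := hg x (x + L - u) (by linarith [hu.2])
        have h2 : K * (x + L - u - x) ≤ K * (2 * L) :=
          mul_le_mul_of_nonneg_left (by linarith [hu.1]) hK
        simp only [indicator_of_mem hu]
        nlinarith
      · simp only [indicator_of_notMem hu]
        nlinarith
    rw [integral_sub hint1 hint2, integral_indicator measurableSet_Ioc, integral_const_mul,
      integral_const_mul] at hle
    have h3 : (e + D) * (3 / 4 * ∫ u, fejer u) ≤ (e + D) * ∫ u in Ioc (-L) L, fejer u :=
      mul_le_mul_of_nonneg_left hL' (by linarith)
    have h4 : 3 * g x - D - 6 * L * K = 3 * e - D := by rw [he]; ring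
    rw [h4]
    linarith

/-- **Esseen's smoothing inequality**: the Kolmogorov distance of two laws, one of which has a
`K`-Lipschitz distribution function, is bounded by `K` and the difference of the characteristic
functions on `(0, 1]`. Other frequency cut-offs follow by scaling the laws. -/
theorem exists_abs_cdf_sub_le : ∃ A : ℝ, 0 < A ∧ ∀ (μ ν : Measure ℝ) [IsProbabilityMeasure μ]
    [IsProbabilityMeasure ν] (K : ℝ) (ψ : ℝ → ℝ), 0 ≤ K →
    (∀ x y, x ≤ y → cdf ν y - cdf ν x ≤ K * (y - x)) → IntervalIntegrable ψ volume 0 1 →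
    (∀ t ∈ Ioc (0 : ℝ) 1, ‖charFun μ t - charFun ν t‖ ≤ t * ψ t) →
    ∀ x, |cdf μ x - cdf ν x| ≤ A * ((∫ t in (0 : ℝ)..1, ψ t) + K) := by
  have hc := integral_fejer_pos
  set c := ∫ u, fejer u with hc_def
  -- a window that carries three quarters of the mass of the kernel
  obtain ⟨L, hL, hL'⟩ : ∃ L : ℝ, 0 < L ∧ 3 / 4 * c ≤ ∫ u in Ioc (-L) L, fejer u := by
    have ht := intervalIntegral_tendsto_integral integrable_fejer tendsto_neg_atTop_atBot
      tendsto_id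
    have hev := ht.eventually (lt_mem_nhds (show 3 / 4 * c < c by linarith))
    obtain ⟨L, h1, h2⟩ := (hev.and (eventually_gt_atTop 0)).exists
    refine ⟨L, h2, ?_⟩
    rw [id, intervalIntegral.integral_of_le (by linarith)] at h1
    exact h1.le
  refine ⟨8 / c + 3 * L, by positivity, ?_⟩
  intro μ ν _ _ K ψ hK hlip hψ h x
  set I := ∫ t in (0 : ℝ)..1, ψ t with hI_def
  set g : ℝ → ℝ := fun y => cdf μ y - cdf ν y with hg_def
  have havg : ∀ b, |∫ u, g (b - u) * fejer u| ≤ 4 * I :=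
    abs_integral_cdf_sub_mul_fejer_le μ ν hψ h
  have hI : 0 ≤ 4 * I := (abs_nonneg _).trans (havg 0)
  have hbdd : BddAbove (range fun y => |g y|) := by
    refine ⟨1, ?_⟩
    rintro _ ⟨y, rfl⟩
    refine abs_le.2 ⟨?_, ?_⟩ <;>
    linarith [cdf_nonneg μ y, cdf_le_one μ y, cdf_nonneg ν y, cdf_le_one ν y]
  set D := ⨆ y, |g y| with hD_def
  have hD : ∀ y, |g y| ≤ D := fun y => le_ciSup hbdd y
  have hgm : Measurable g := (monotone_cdf μ).measurable.sub (monotone_cdf ν).measurable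
  have hg : ∀ y z, y ≤ z → g y - K * (z - y) ≤ g z := fun y z hyz => by
    have h1 := hlip y z hyz
    have h2 := monotone_cdf μ hyz
    simp only [hg_def]
    linarith
  have hupper : ∀ y, (3 * g y - D - 6 * L * K) * c ≤ 4 * (4 * I) := fun y =>
    mul_integral_fejer_le_of_average_le hL' hK hI hg hD hgm ((le_abs_self _).trans (havg _))
  -- the reflected function `y ↦ -g (-y)` satisfies the same hypotheses
  have hlower : ∀ y, (3 * -g y - D - 6 * L * K) * c ≤ 4 * (4 * I) := fun y => by
    have := mul_integral_fejer_le_of_average_le (g := fun y => -g (-y)) (x := -y) (M := 4 * I)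
      (D := D) hL' hK hI
      (fun a b hab => by have := hg (-b) (-a) (by linarith); linarith)
      (fun a => by rw [abs_neg]; exact hD _) (hgm.comp measurable_neg).neg (by
        have h1 : ∫ u, -g (-(-y + L - u)) * fejer u = -∫ u, g (y - L - u) * fejer u := by
          rw [← integral_neg_eq_self, ← integral_neg]
          congr 1 with u
          rw [fejer_neg, show -(-y + L - -u) = y - L - u by ring]
          ring
        rw [h1]
        exact (neg_le_abs _).trans (havg _))
    simpa using this
  have hboth : ∀ y, 3 * |g y| ≤ D + 6 * L * K + 16 * I / c := fun y => by
    have hu := hupper y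
    have hl := hlower y
    rw [← le_div_iff₀ hc] at hu hl
    rcases abs_cases (g y) with ⟨h1, -⟩ | ⟨h1, -⟩ <;> rw [h1] <;>
    linarith [show 4 * (4 * I) / c = 16 * I / c by ring]
  have hsup : D ≤ (D + 6 * L * K + 16 * I / c) / 3 := ciSup_le fun y => by linarith [hboth y]
  have hfin : D ≤ 3 * L * K + 8 * I / c := by linarith [show 16 * I / c = 2 * (8 * I / c) by ring]
  calc |cdf μ x - cdf ν x| ≤ 3 * L * K + 8 * I / c := (hD x).trans hfin
    _ ≤ (8 / c + 3 * L) * (I + K) := by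
      have h1 : 0 ≤ 8 / c * K := by positivity
      have h2 : 0 ≤ L * I := mul_nonneg hL.le (by linarith)
      have h3 : 8 * I / c = 8 / c * I := by ring
      rw [h3]
      nlinarith

/-! ### Characteristic functions of standardised laws -/

/-- The constant is not optimal; only a bound that holds on the whole line matters. -/
lemma norm_exp_mul_I_sub_taylor_le (x : ℝ) :
    ‖Complex.exp (x * Complex.I) - 1 - x * Complex.I + x ^ 2 / 2‖ ≤ 4 * |x| ^ 3 := by
  have hn : ‖(x : ℂ) * Complex.I‖ = |x| := by simp
  rcases le_or_gt |x| 1 with h | h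
  · have := Complex.exp_bound (x := x * Complex.I) (by rw [hn]; exact h) (n := 3) (by norm_num)
    rw [hn] at this
    simp only [Finset.sum_range_succ, Finset.sum_range_zero, Nat.factorial] at this
    have hI : ((x : ℂ) * Complex.I) ^ 2 = -x ^ 2 := by
      rw [mul_pow, Complex.I_sq]; ring
    rw [hI] at this
    have he : Complex.exp (x * Complex.I) - 1 - x * Complex.I + x ^ 2 / 2
        = Complex.exp (x * Complex.I) - (0 + (x * Complex.I) ^ 0 / ((1 : ℕ) : ℂ)
          + (x * Complex.I) ^ 1 / (((0 + 1) * 1 : ℕ) : ℂ)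
          + -x ^ 2 / (((1 + 1) * ((0 + 1) * 1) : ℕ) : ℂ)) := by
      push_cast; ring
    rw [he]
    refine this.trans ?_
    have h3 : 0 ≤ |x| ^ 3 := by positivity
    norm_num
    nlinarith
  · have h1 : ‖Complex.exp (x * Complex.I) - 1 - x * Complex.I + x ^ 2 / 2‖
        ≤ 1 + 1 + |x| + |x| ^ 2 / 2 := by
      refine (norm_add_le _ _).trans (add_le_add ((norm_sub_le _ _).trans
        (add_le_add ((norm_sub_le _ _).trans (add_le_add ?_ ?_)) ?_)) ?_)
      · exact (Complex.norm_exp_ofReal_mul_I x).le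
      · simp
      · exact hn.le
      · simp
    refine h1.trans ?_
    have h2 : |x| ≤ |x| ^ 3 := le_self_pow₀ h.le (by norm_num)
    have h3 : |x| ^ 2 ≤ |x| ^ 3 := pow_le_pow_right₀ h.le (by norm_num)
    have h4 : 1 ≤ |x| ^ 3 := one_le_pow₀ h.le
    linarith

section

variable {μ : Measure ℝ} [IsProbabilityMeasure μ]

lemma integrable_id_of_integrable_abs_pow_three (h3 : Integrable (fun x => |x| ^ 3) μ) :
    Integrable (fun x => x) μ := by
  refine ((integrable_const 1).add h3).mono' measurable_id.aestronglyMeasurable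
    (ae_of_all _ fun x => ?_)
  simp only [Real.norm_eq_abs, Pi.add_apply]
  nlinarith [abs_nonneg x, sq_nonneg (|x| - 1), mul_nonneg (abs_nonneg x) (sq_nonneg (|x| - 1))]

lemma integrable_sq_of_integrable_abs_pow_three (h3 : Integrable (fun x => |x| ^ 3) μ) :
    Integrable (fun x => x ^ 2) μ := by
  refine ((integrable_const 1).add h3).mono' (measurable_id.pow_const 2).aestronglyMeasurable
    (ae_of_all _ fun x => ?_)
  simp only [Real.norm_eq_abs, Pi.add_apply, abs_pow]
  nlinarith [abs_nonneg x, sq_nonneg (|x| - 1), mul_nonneg (abs_nonneg x) (sq_nonneg (|x| - 1))]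

lemma one_le_integral_abs_pow_three (h3 : Integrable (fun x => |x| ^ 3) μ)
    (hvar : ∫ x, x ^ 2 ∂μ = 1) : 1 ≤ ∫ x, |x| ^ 3 ∂μ := by
  have h2 := integrable_sq_of_integrable_abs_pow_three h3
  -- Young's inequality `3 x² ≤ 2 |x|³ + 1`
  have : ∫ x, 3 * x ^ 2 ∂μ ≤ ∫ x, (2 * |x| ^ 3 + 1) ∂μ := by
    refine integral_mono (h2.const_mul 3) ((h3.const_mul 2).add (integrable_const 1)) fun x => ?_
    simp only
    rw [← sq_abs x]
    nlinarith [abs_nonneg x, sq_nonneg (|x| - 1), mul_nonneg (abs_nonneg x) (sq_nonneg (|x| - 1))]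
  rw [integral_const_mul, integral_add (h3.const_mul 2) (integrable_const 1), integral_const_mul,
    hvar] at this
  simp at this
  linarith

lemma norm_charFun_sub_taylor_le (h3 : Integrable (fun x => |x| ^ 3) μ)
    (hmean : ∫ x, x ∂μ = 0) (hvar : ∫ x, x ^ 2 ∂μ = 1) (s : ℝ) :
    ‖charFun μ s - (1 - (s : ℂ) ^ 2 / 2)‖ ≤ 4 * (∫ x, |x| ^ 3 ∂μ) * |s| ^ 3 := by
  have h1 := integrable_id_of_integrable_abs_pow_three h3
  have h2 := integrable_sq_of_integrable_abs_pow_three h3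
  have hexp : Integrable (fun x : ℝ => Complex.exp (((s * x : ℝ) : ℂ) * Complex.I)) μ :=
    Integrable.of_bound (C := 1) (Continuous.aestronglyMeasurable (by fun_prop))
      (ae_of_all _ fun w => (Complex.norm_exp_ofReal_mul_I _).le)
  have hlin : Integrable (fun x : ℝ => ((s * x : ℝ) : ℂ) * Complex.I) μ :=
    ((h1.const_mul s).ofReal).mul_const _
  have hquad : Integrable (fun x : ℝ => ((s * x : ℝ) : ℂ) ^ 2 / 2) μ := by
    have : (fun x : ℝ => ((s * x : ℝ) : ℂ) ^ 2 / 2)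
        = fun x : ℝ => ((s ^ 2 / 2 * x ^ 2 : ℝ) : ℂ) := by
      ext x; push_cast; ring
    rw [this]
    exact (h2.const_mul _).ofReal
  have hlin0 : ∫ x : ℝ, ((s * x : ℝ) : ℂ) * Complex.I ∂μ = 0 := by
    rw [integral_mul_const, integral_complex_ofReal, integral_const_mul, hmean]
    simp
  have hquad0 : ∫ x : ℝ, ((s * x : ℝ) : ℂ) ^ 2 / 2 ∂μ = (s : ℂ) ^ 2 / 2 := by
    have : (fun x : ℝ => ((s * x : ℝ) : ℂ) ^ 2 / 2)
        = fun x : ℝ => ((s ^ 2 / 2 * x ^ 2 : ℝ) : ℂ) := by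
      ext x; push_cast; ring
    rw [this, integral_complex_ofReal, integral_const_mul, hvar]
    push_cast; ring
  have hkey : charFun μ s - (1 - (s : ℂ) ^ 2 / 2) = ∫ x : ℝ,
      (Complex.exp (((s * x : ℝ) : ℂ) * Complex.I)
      - 1 - ((s * x : ℝ) : ℂ) * Complex.I + ((s * x : ℝ) : ℂ) ^ 2 / 2) ∂μ := by
    have he1 : Integrable (fun x : ℝ => Complex.exp (((s * x : ℝ) : ℂ) * Complex.I) - 1) μ :=
      hexp.sub (integrable_const 1)
    have he2 : Integrable (fun x : ℝ => Complex.exp (((s * x : ℝ) : ℂ) * Complex.I) - 1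
        - ((s * x : ℝ) : ℂ) * Complex.I) μ := he1.sub hlin
    rw [integral_add he2 hquad, integral_sub he1 hlin, integral_sub hexp (integrable_const 1),
      hlin0, hquad0, charFun_apply_real]
    push_cast
    simp
    ring
  rw [hkey]
  refine (norm_integral_le_of_norm_le (h3.const_mul (4 * |s| ^ 3))
    (ae_of_all _ fun x => ?_)).trans (le_of_eq ?_)
  · refine (norm_exp_mul_I_sub_taylor_le (s * x)).trans (le_of_eq ?_)
    rw [abs_mul]; ring
  · rw [integral_const_mul]; ring

lemma norm_pow_sub_pow_le_of_norm_le {a b : ℂ} {q : ℝ} (ha : ‖a‖ ≤ q) (hb : ‖b‖ ≤ q) (n : ℕ) :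
    ‖a ^ n - b ^ n‖ ≤ n * q ^ (n - 1) * ‖a - b‖ := by
  have hq : 0 ≤ q := (norm_nonneg a).trans ha
  rw [← (Commute.all a b).mul_geom_sum₂ n, norm_mul, mul_comm]
  refine mul_le_mul_of_nonneg_right ?_ (norm_nonneg _)
  refine (norm_sum_le_of_le _ (f := fun i => a ^ i * b ^ (n - 1 - i))
    (n := fun _ => q ^ (n - 1)) fun i hi => ?_).trans (by simp)
  rw [norm_mul, norm_pow, norm_pow]
  calc ‖a‖ ^ i * ‖b‖ ^ (n - 1 - i) ≤ q ^ i * q ^ (n - 1 - i) := by gcongr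
    _ = q ^ (n - 1) := by
      rw [← pow_add]; congr 1; have := Finset.mem_range.1 hi; omega

/-- Within the range `ρ s ≤ 1 / 16`, with `ρ` the third absolute moment, the characteristic function
of a sum of `n` independent standardised variables stays close to the Gaussian one. -/
lemma norm_charFun_pow_sub_exp_le (h3 : Integrable (fun x => |x| ^ 3) μ)
    (hmean : ∫ x, x ∂μ = 0) (hvar : ∫ x, x ^ 2 ∂μ = 1) {n : ℕ} (hn : 0 < n) {s : ℝ} (hs : 0 ≤ s)
    (hρs : (∫ x, |x| ^ 3 ∂μ) * s ≤ 1 / 16) :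
    ‖charFun μ s ^ n - (Real.exp (-(n * s ^ 2 / 2)) : ℂ)‖ ≤
      10 * n * (∫ x, |x| ^ 3 ∂μ) * s ^ 3 * Real.exp (-(n * s ^ 2 / 4)) := by
  have hρ := one_le_integral_abs_pow_three h3 hvar
  have hT := norm_charFun_sub_taylor_le h3 hmean hvar s
  set ρ := ∫ x, |x| ^ 3 ∂μ with hρ_def
  rw [abs_of_nonneg hs] at hT
  have hs1 : s ≤ 1 / 16 := by nlinarith
  have hs3 : ρ * s ^ 3 ≤ s ^ 2 / 16 := by nlinarith [sq_nonneg s]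
  have ha : ‖charFun μ s‖ ≤ Real.exp (-(s ^ 2 / 4)) := by
    have h1 : ‖(1 - s ^ 2 / 2 : ℂ)‖ = 1 - s ^ 2 / 2 := by
      rw [show (1 - s ^ 2 / 2 : ℂ) = ((1 - s ^ 2 / 2 : ℝ) : ℂ) by push_cast; ring,
        Complex.norm_real, Real.norm_of_nonneg (by nlinarith)]
    have h2 : ‖charFun μ s‖ ≤ ‖(1 - s ^ 2 / 2 : ℂ)‖ + ‖charFun μ s - (1 - s ^ 2 / 2)‖ := by
      calc ‖charFun μ s‖ = ‖(1 - s ^ 2 / 2 : ℂ) + (charFun μ s - (1 - s ^ 2 / 2))‖ := by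
            congr 1; ring
        _ ≤ _ := norm_add_le _ _
    rw [h1] at h2
    have h4 := Real.add_one_le_exp (-(s ^ 2 / 4))
    linarith
  have hb : ‖(Real.exp (-(s ^ 2 / 2)) : ℂ)‖ ≤ Real.exp (-(s ^ 2 / 4)) := by
    rw [Complex.norm_real, Real.norm_of_nonneg (Real.exp_pos _).le]
    exact Real.exp_le_exp.2 (by nlinarith [sq_nonneg s])
  have hab : ‖charFun μ s - (Real.exp (-(s ^ 2 / 2)) : ℂ)‖ ≤ 5 * ρ * s ^ 3 := by
    have h1 : ‖((1 - s ^ 2 / 2 : ℂ)) - (Real.exp (-(s ^ 2 / 2)) : ℂ)‖ ≤ ρ * s ^ 3 := by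
      rw [show (1 - s ^ 2 / 2 : ℂ) - (Real.exp (-(s ^ 2 / 2)) : ℂ)
        = (-(Real.exp (-(s ^ 2 / 2)) - 1 - -(s ^ 2 / 2)) : ℝ) by push_cast; ring,
        Complex.norm_real, norm_neg]
      have hy : ‖-(s ^ 2 / 2)‖ ≤ 1 := by
        rw [norm_neg, Real.norm_of_nonneg (by positivity)]; nlinarith
      refine (Real.norm_exp_sub_one_sub_id_le hy).trans ?_
      rw [norm_neg, Real.norm_of_nonneg (by positivity)]
      have h5 : s ^ 3 * s ≤ s ^ 3 * ρ := by gcongr; linarith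
      have h6 : 0 ≤ s ^ 3 * ρ := by positivity
      nlinarith
    calc _ ≤ ‖charFun μ s - (1 - s ^ 2 / 2)‖
          + ‖((1 - s ^ 2 / 2 : ℂ)) - (Real.exp (-(s ^ 2 / 2)) : ℂ)‖ :=
        norm_sub_le_norm_sub_add_norm_sub _ _ _
      _ ≤ 5 * ρ * s ^ 3 := by linarith
  have hpow : (Real.exp (-(n * s ^ 2 / 2)) : ℂ) = (Real.exp (-(s ^ 2 / 2)) : ℂ) ^ n := by
    rw [← Complex.ofReal_pow, ← Real.exp_nat_mul]
    congr 2
    ring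
  rw [hpow]
  refine (norm_pow_sub_pow_le_of_norm_le ha hb n).trans ?_
  have hexp : Real.exp (-(s ^ 2 / 4)) ^ (n - 1)
      = Real.exp (s ^ 2 / 4) * Real.exp (-(n * s ^ 2 / 4)) := by
    rw [← Real.exp_nat_mul, ← Real.exp_add, Nat.cast_pred hn]
    congr 1
    ring
  have hexp2 : Real.exp (s ^ 2 / 4) ≤ 2 := by
    have := Real.abs_exp_sub_one_le (x := s ^ 2 / 4)
      (by rw [abs_of_nonneg (by positivity)]; nlinarith)
    rw [abs_of_nonneg (a := s ^ 2 / 4) (by positivity)] at this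
    nlinarith [le_abs_self (Real.exp (s ^ 2 / 4) - 1)]
  rw [hexp]
  calc _ ≤ n * (2 * Real.exp (-(n * s ^ 2 / 4))) * (5 * ρ * s ^ 3) := by gcongr
    _ = _ := by ring

end

/-! ### The normal distribution function -/

lemma cdf_gaussianReal_sub_le {m : ℝ} {v : NNReal} (hv : v ≠ 0) {x y K : ℝ} (hxy : x ≤ y)
    (hK : ∀ z ∈ Ioc x y, gaussianPDFReal m v z ≤ K) :
    cdf (gaussianReal m v) y - cdf (gaussianReal m v) x ≤ K * (y - x) := by
  rw [← measureReal_Ioc_eq_cdf_sub _ hxy, measureReal_def, gaussianReal_apply_eq_integral _ hv,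
    ENNReal.toReal_ofReal (setIntegral_nonneg measurableSet_Ioc
      fun z _ => gaussianPDFReal_nonneg m v z)]
  calc ∫ z in Ioc x y, gaussianPDFReal m v z ≤ ∫ _ in Ioc x y, K :=
        setIntegral_mono_on (integrable_gaussianPDFReal m v).integrableOn (integrable_const K)
          measurableSet_Ioc hK
    _ = K * (y - x) := by
        simp [hxy, mul_comm]

lemma gaussianPDFReal_sq_le {T : ℝ} (hT : 0 < T) (z : ℝ) :
    gaussianPDFReal 0 (NNReal.mk (T ^ 2) (sq_nonneg T)) z ≤ T⁻¹ := by
  rw [gaussianPDFReal]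
  have h1 : Real.exp (-(z - 0) ^ 2 / (2 * (NNReal.mk (T ^ 2) (sq_nonneg T)))) ≤ 1 := by
    refine Real.exp_le_one_iff.2 (div_nonpos_of_nonpos_of_nonneg (by nlinarith [sq_nonneg z]) ?_)
    positivity
  have h2 : T ≤ √(2 * Real.pi * (NNReal.mk (T ^ 2) (sq_nonneg T))) := by
    refine Real.le_sqrt_of_sq_le ?_
    simp only [NNReal.coe_mk]
    nlinarith [Real.pi_gt_three, sq_nonneg T]
  calc _ ≤ (√(2 * Real.pi * (NNReal.mk (T ^ 2) (sq_nonneg T))))⁻¹ * 1 := by gcongr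
    _ ≤ T⁻¹ := by rw [mul_one]; gcongr

lemma cdf_gaussianReal_mul {T : ℝ} (hT : 0 < T) (x : ℝ) :
    cdf (gaussianReal 0 (NNReal.mk (T ^ 2) (sq_nonneg T))) (T * x) = cdf (gaussianReal 0 1) x := by
  have h := gaussianReal_map_const_mul (μ := 0) (v := 1) T
  rw [mul_zero, mul_one] at h
  rw [cdf_eq_real, cdf_eq_real, ← h, map_measureReal_apply (measurable_const_mul T)
    measurableSet_Iic]
  congr 1
  ext y
  exact mul_le_mul_iff_right₀ hT

/-! ### The Berry–Esseen theorem -/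

lemma integral_exp_neg_sq_le {T : ℝ} (hT : 0 < T) :
    ∫ t in (0 : ℝ)..1, Real.exp (-(T ^ 2 / 8) * t ^ 2) ≤ 6 / T := by
  have hb : 0 < T ^ 2 / 8 := by positivity
  rw [intervalIntegral.integral_of_le zero_le_one]
  calc _ ≤ ∫ t, Real.exp (-(T ^ 2 / 8) * t ^ 2) :=
        setIntegral_le_integral (integrable_exp_neg_mul_sq hb)
          (ae_of_all _ fun t => (Real.exp_pos _).le)
    _ = √(Real.pi / (T ^ 2 / 8)) := integral_gaussian _
    _ ≤ 6 / T := by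
      refine Real.sqrt_le_iff.2 ⟨by positivity, ?_⟩
      rw [div_pow, div_div_eq_mul_div]
      gcongr
      linarith [Real.pi_lt_four]

/-- The **Berry–Esseen theorem** for identically distributed standardised variables with finite
third absolute moment. -/
theorem exists_abs_measureReal_sum_le_sub_cdf_le : ∃ C : ℝ, 0 < C ∧
    ∀ (Ω : Type*) [MeasurableSpace Ω] (P : Measure Ω) [IsProbabilityMeasure P] (n : ℕ)
      (X : Fin n → Ω → ℝ) (μ : Measure ℝ) [IsProbabilityMeasure μ], 0 < n →
      (∀ i, AEMeasurable (X i) P) → (∀ i, P.map (X i) = μ) → iIndepFun X P →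
      Integrable (fun x => |x| ^ 3) μ → ∫ x, x ∂μ = 0 → ∫ x, x ^ 2 ∂μ = 1 →
      ∀ x, |P.real {ω | ∑ i, X i ω ≤ √n * x} - cdf (gaussianReal 0 1) x|
        ≤ C * ((∫ x, |x| ^ 3 ∂μ) / √n) := by
  obtain ⟨A, hA, hsmooth⟩ := exists_abs_cdf_sub_le
  refine ⟨496 * A, by positivity, ?_⟩
  intro Ω _ P _ n X μ _ hn hX hlaw hindep h3 hmean hvar x
  have hρ := one_le_integral_abs_pow_three h3 hvar
  set ρ := ∫ x, |x| ^ 3 ∂μ with hρ_def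
  have hsn : 0 < √(n : ℝ) := Real.sqrt_pos.2 (by exact_mod_cast hn)
  have hsn2 : √(n : ℝ) ^ 2 = n := Real.sq_sqrt n.cast_nonneg
  -- the frequency cut-off; it is moved to `1` by scaling the normalised sum by `T`
  set T := √(n : ℝ) / (16 * ρ) with hT_def
  have hT : 0 < T := by positivity
  have hnT : (n : ℝ) = 256 * ρ ^ 2 * T ^ 2 := by
    rw [hT_def, div_pow, hsn2]; field_simp; norm_num
  have hSm : AEMeasurable (fun ω => ∑ i, X i ω) P :=
    Finset.aemeasurable_fun_sum _ fun i _ => hX i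
  set S := P.map (fun ω => (16 * ρ)⁻¹ * ∑ i, X i ω) with hS
  have hSm' : AEMeasurable (fun ω => (16 * ρ)⁻¹ * ∑ i, X i ω) P := hSm.const_mul _
  have : IsProbabilityMeasure S := Measure.isProbabilityMeasure_map hSm'
  have hcharS : ∀ t, charFun S t = charFun μ ((16 * ρ)⁻¹ * t) ^ n := by
    intro t
    rw [hS, charFun_map_mul_comp hSm, iIndepFun.charFun_map_fun_sum_eq_prod hX hindep]
    simp [hlaw]
  have hbound : ∀ t ∈ Ioc (0 : ℝ) 1, ‖charFun S t
      - charFun (gaussianReal 0 (NNReal.mk (T ^ 2) (sq_nonneg T))) t‖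
      ≤ t * (5 * Real.exp (-(T ^ 2 / 8) * t ^ 2)) := by
    intro t ht
    have hns : n * ((16 * ρ)⁻¹ * t) ^ 2 = T ^ 2 * t ^ 2 := by
      rw [hnT]; field_simp; norm_num
    have hg : charFun (gaussianReal 0 (NNReal.mk (T ^ 2) (sq_nonneg T))) t
        = (Real.exp (-(n * ((16 * ρ)⁻¹ * t) ^ 2 / 2)) : ℂ) := by
      rw [charFun_gaussianReal, hns]
      push_cast
      congr 1
      simp
    rw [hcharS, hg]
    refine (norm_charFun_pow_sub_exp_le h3 hmean hvar hn
      (mul_nonneg (by positivity) ht.1.le) ?_).trans ?_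
    · rw [← hρ_def]
      have : ρ * ((16 * ρ)⁻¹ * t) = t / 16 := by field_simp
      rw [this]
      linarith [ht.2]
    · rw [← hρ_def, hns]
      have h1 : 10 * n * ρ * ((16 * ρ)⁻¹ * t) ^ 3 = t * (5 * (T ^ 2 * t ^ 2 / 8)) := by
        rw [hnT]; field_simp; ring
      have h2 : Real.exp (-(T ^ 2 * t ^ 2 / 4))
          = Real.exp (-(T ^ 2 / 8) * t ^ 2) * Real.exp (-(T ^ 2 * t ^ 2 / 8)) := by
        rw [← Real.exp_add]; congr 1; ring
      have h4 : T ^ 2 * t ^ 2 / 8 * Real.exp (-(T ^ 2 * t ^ 2 / 8)) ≤ 1 := by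
        rw [Real.exp_neg, ← div_eq_mul_inv, div_le_one (Real.exp_pos _)]
        linarith [Real.add_one_le_exp (T ^ 2 * t ^ 2 / 8)]
      rw [h1, h2]
      calc _ = t * (5 * Real.exp (-(T ^ 2 / 8) * t ^ 2))
            * (T ^ 2 * t ^ 2 / 8 * Real.exp (-(T ^ 2 * t ^ 2 / 8))) := by ring
        _ ≤ _ := mul_le_of_le_one_right (mul_nonneg ht.1.le (by positivity)) h4
  have hv : NNReal.mk (T ^ 2) (sq_nonneg T) ≠ 0 := by
    rw [ne_eq, ← NNReal.coe_eq_zero]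
    simpa using hT.ne'
  have hmain := hsmooth S (gaussianReal 0 (NNReal.mk (T ^ 2) (sq_nonneg T))) T⁻¹
    (fun t => 5 * Real.exp (-(T ^ 2 / 8) * t ^ 2)) (by positivity)
    (fun x y hxy => cdf_gaussianReal_sub_le hv hxy fun z _ => gaussianPDFReal_sq_le hT z)
    (Continuous.intervalIntegrable (by fun_prop) _ _) hbound (T * x)
  have hcdf : cdf S (T * x) = P.real {ω | ∑ i, X i ω ≤ √n * x} := by
    rw [cdf_eq_real, hS, measureReal_def, measureReal_def,
      Measure.map_apply_of_aemeasurable hSm' measurableSet_Iic]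
    congr 2
    ext ω
    simp only [mem_preimage, mem_Iic, mem_ofPred_eq, hT_def]
    rw [inv_mul_le_iff₀ (by positivity)]
    have : 16 * ρ * (√n / (16 * ρ) * x) = √n * x := by field_simp
    rw [this]
  rw [cdf_gaussianReal_mul hT, hcdf] at hmain
  refine hmain.trans ?_
  rw [intervalIntegral.integral_const_mul]
  calc A * (5 * (∫ t in (0 : ℝ)..1, Real.exp (-(T ^ 2 / 8) * t ^ 2)) + T⁻¹)
      ≤ A * (5 * (6 / T) + T⁻¹) := by
        gcongr
        exact integral_exp_neg_sq_le hT
    _ = 496 * A * (ρ / √n) := by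
        rw [hT_def]; field_simp; norm_num

/-! ### Perturbing the argument of the normal distribution function -/

lemma abs_cdf_gaussianReal_sub_le (x y : ℝ) :
    |cdf (gaussianReal 0 1) y - cdf (gaussianReal 0 1) x| ≤ |y - x| := by
  have key : ∀ x y : ℝ, x ≤ y →
      |cdf (gaussianReal 0 1) y - cdf (gaussianReal 0 1) x| ≤ |y - x| := by
    intro x y hxy
    rw [abs_of_nonneg (sub_nonneg.2 (monotone_cdf _ hxy)), abs_of_nonneg (sub_nonneg.2 hxy)]
    have h1 : (1 : NNReal) = NNReal.mk (1 ^ 2) (sq_nonneg 1) := by ext; simp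
    have := cdf_gaussianReal_sub_le (m := 0) (v := 1) (K := 1) one_ne_zero hxy
      fun z _ => by rw [h1]; simpa using gaussianPDFReal_sq_le one_pos z
    linarith
  rcases le_total x y with h | h
  · exact key x y h
  · rw [abs_sub_comm, abs_sub_comm y x]; exact key y x h

lemma gaussianPDFReal_mul_abs_le_one (z : ℝ) : gaussianPDFReal 0 1 z * |z| ≤ 1 := by
  rw [gaussianPDFReal]
  have h1 : 1 ≤ √(2 * Real.pi * (1 : NNReal)) := by
    refine Real.one_le_sqrt.2 ?_
    simp only [NNReal.coe_one]
    linarith [Real.pi_gt_three]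
  have h2 : |z| ≤ Real.exp (z ^ 2 / 2) := by
    have := Real.add_one_le_exp (z ^ 2 / 2)
    rw [← sq_abs] at this ⊢
    nlinarith [sq_nonneg (|z| - 1)]
  have h3 : Real.exp (-(z - 0) ^ 2 / (2 * (1 : NNReal))) = (Real.exp (z ^ 2 / 2))⁻¹ := by
    rw [← Real.exp_neg]; congr 1; simp; ring
  rw [h3]
  calc _ ≤ 1 * (Real.exp (z ^ 2 / 2))⁻¹ * Real.exp (z ^ 2 / 2) := by
        gcongr
        exact inv_le_one_of_one_le₀ h1
    _ = 1 := by rw [one_mul, inv_mul_cancel₀ (Real.exp_pos _).ne']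

/-- Dilation is a relative perturbation: the density at distance `|x|` from the origin is at
most `1 / |x|`, which compensates the length `(r - 1) |x|` of the interval. -/
lemma abs_cdf_gaussianReal_mul_sub_le {r : ℝ} (hr : 1 ≤ r) (x : ℝ) :
    |cdf (gaussianReal 0 1) (r * x) - cdf (gaussianReal 0 1) x| ≤ r - 1 := by
  have hpdf : ∀ z, 0 < |x| → |x| ≤ |z| → gaussianPDFReal 0 1 z ≤ |x|⁻¹ := by
    intro z hx hz
    rw [← one_div, le_div_iff₀ hx]
    exact (mul_le_mul_of_nonneg_left hz (gaussianPDFReal_nonneg _ _ _)).trans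
      (gaussianPDFReal_mul_abs_le_one z)
  rcases lt_trichotomy x 0 with hx | rfl | hx
  · have hxy : r * x ≤ x := by nlinarith
    have ha : 0 < |x| := abs_pos.2 hx.ne
    rw [abs_sub_comm, abs_of_nonneg (sub_nonneg.2 (monotone_cdf _ hxy))]
    refine (cdf_gaussianReal_sub_le one_ne_zero hxy fun z hz => hpdf z ha ?_).trans (le_of_eq ?_)
    · exact abs_le_abs_of_nonpos hx.le hz.2
    · have := hx.ne
      rw [abs_of_neg hx]; field_simp; ring
  · simpa using hr
  · have hxy : x ≤ r * x := by nlinarith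
    have ha : 0 < |x| := abs_pos.2 hx.ne'
    rw [abs_of_nonneg (sub_nonneg.2 (monotone_cdf _ hxy))]
    refine (cdf_gaussianReal_sub_le one_ne_zero hxy fun z hz => hpdf z ha ?_).trans (le_of_eq ?_)
    · exact abs_le_abs_of_nonneg hx.le hz.1.le
    · rw [abs_of_pos hx]; field_simp

/-! ### The Huber score -/

/-- The truncation of `u` to `[-τ, τ]`; for `τ > 0` it is the derivative of the Huber loss. -/
noncomputable def clip (τ u : ℝ) : ℝ := max (-τ) (min u τ)

lemma measurable_clip (τ : ℝ) : Measurable (clip τ) :=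
  measurable_const.max (measurable_id.min measurable_const)

section

variable {τ : ℝ}

lemma clip_of_abs_le {u : ℝ} (h : |u| ≤ τ) : clip τ u = u := by
  rw [clip, min_eq_left (abs_le.1 h).2, max_eq_right (abs_le.1 h).1]

lemma clip_of_lt {u : ℝ} (hτ : 0 < τ) (h : τ < u) : clip τ u = τ := by
  rw [clip, min_eq_right h.le, max_eq_right (by linarith)]

lemma clip_of_lt_neg {u : ℝ} (hτ : 0 < τ) (h : u < -τ) : clip τ u = -τ := by
  rw [clip, min_eq_left (by linarith), max_eq_left h.le]

lemma abs_clip_le (hτ : 0 < τ) (u : ℝ) : |clip τ u| ≤ τ :=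
  abs_le.2 ⟨le_max_left _ _, max_le (by linarith) (min_le_right _ _)⟩

lemma abs_clip_le_abs (hτ : 0 < τ) (u : ℝ) : |clip τ u| ≤ |u| := by
  rcases le_or_gt |u| τ with h | h
  · rw [clip_of_abs_le h]
  · exact (abs_clip_le hτ u).trans h.le

lemma abs_clip_sub_clip_le (u y : ℝ) : |clip τ y - clip τ u| ≤ |y - u| :=
  (abs_max_sub_max_le_max _ _ _ _).trans (by
    rw [sub_self, abs_zero, max_eq_right (abs_nonneg _)]
    refine (abs_min_sub_min_le_max _ _ _ _).trans ?_
    simp)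

lemma huberLoss_eq_clip (hτ : 0 < τ) (u : ℝ) :
    huberLoss τ u = clip τ u * u - clip τ u ^ 2 / 2 := by
  rw [huberLoss]
  split_ifs with h
  · rw [clip_of_abs_le h]; ring
  · rcases lt_abs.1 (not_le.1 h) with h1 | h1
    · rw [clip_of_lt hτ h1, abs_of_pos (hτ.trans h1)]
    · rw [clip_of_lt_neg hτ (by linarith), abs_of_neg (by linarith)]; ring

/-- The Huber loss is the convex conjugate of `c ↦ c² / 2` restricted to `[-τ, τ]`. -/
lemma mul_sub_sq_le_huberLoss (hτ : 0 < τ) {c : ℝ} (hc : |c| ≤ τ) (u : ℝ) :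
    c * u - c ^ 2 / 2 ≤ huberLoss τ u := by
  obtain ⟨hc1, hc2⟩ := abs_le.1 hc
  rw [huberLoss_eq_clip hτ]
  rcases le_or_gt |u| τ with h | h
  · rw [clip_of_abs_le h]; nlinarith [sq_nonneg (u - c)]
  · rcases lt_abs.1 h with h1 | h1
    · rw [clip_of_lt hτ h1]; nlinarith [mul_nonneg (sub_nonneg.2 hc2) (sub_nonneg.2 h1.le)]
    · rw [clip_of_lt_neg hτ (by linarith)]
      nlinarith [mul_nonneg (show 0 ≤ τ + c by linarith) (show 0 ≤ -u - τ by linarith)]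

lemma deriv_huberLoss (hτ : 0 < τ) (u : ℝ) : deriv (huberLoss τ) u = clip τ u := by
  refine HasDerivAt.deriv ?_
  rw [hasDerivAt_iff_isLittleO]
  refine Asymptotics.IsBigO.trans_isLittleO (g := fun y => (y - u) ^ 2) ?_ ?_
  · refine Asymptotics.IsBigO.of_bound 1 (Eventually.of_forall fun y => ?_)
    have h1 := mul_sub_sq_le_huberLoss hτ (abs_clip_le hτ u) y
    have h2 := mul_sub_sq_le_huberLoss hτ (abs_clip_le hτ y) u
    have h3 := huberLoss_eq_clip hτ u
    have h4 := huberLoss_eq_clip hτ y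
    have h5 : (clip τ y - clip τ u) * (y - u) ≤ (y - u) ^ 2 := by
      refine (le_abs_self _).trans ?_
      rw [abs_mul, ← sq_abs (y - u), sq]
      exact mul_le_mul_of_nonneg_right (abs_clip_sub_clip_le u y) (abs_nonneg _)
    rw [Real.norm_of_nonneg (sq_nonneg _), one_mul, smul_eq_mul, Real.norm_eq_abs, abs_le]
    constructor <;> nlinarith [sq_nonneg (y - u)]
  · have h : Tendsto (fun y : ℝ => y - u) (𝓝 u) (𝓝 0) := by
      simpa using (continuous_sub_right u).tendsto u
    exact (Asymptotics.isLittleO_pow_id (𝕜 := ℝ) (n := 2) one_lt_two).comp_tendsto h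

lemma abs_clip_sub_le_rpow (hτ : 0 < τ) {κ : ℝ} (hκ : 3 ≤ κ) (u : ℝ) :
    |clip τ u - u| ≤ |u| ^ κ * τ ^ (1 - κ) := by
  rcases le_or_gt |u| τ with h | h
  · rw [clip_of_abs_le h, sub_self, abs_zero]; positivity
  · have hu : 0 < |u| := hτ.trans h
    have h1 : |clip τ u - u| ≤ |u| := by
      rcases lt_abs.1 h with h1 | h1
      · rw [clip_of_lt hτ h1, abs_of_pos (hτ.trans h1), abs_le]
        constructor <;> linarith
      · rw [clip_of_lt_neg hτ (by linarith), abs_of_neg (show u < 0 by linarith), abs_le]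
        constructor <;> linarith
    calc |clip τ u - u| ≤ |u| := h1
      _ = |u| ^ κ * |u| ^ (1 - κ) := by
        rw [← Real.rpow_add hu]; simp
      _ ≤ |u| ^ κ * τ ^ (1 - κ) := mul_le_mul_of_nonneg_left
        (Real.rpow_le_rpow_of_nonpos hτ h.le (by linarith)) (by positivity)

lemma sq_sub_clip_sq_le_rpow (hτ : 0 < τ) {κ : ℝ} (hκ : 3 ≤ κ) (u : ℝ) :
    u ^ 2 - clip τ u ^ 2 ≤ |u| ^ κ * τ ^ (2 - κ) := by
  rcases le_or_gt |u| τ with h | h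
  · rw [clip_of_abs_le h, sub_self]; positivity
  · have hu : 0 < |u| := hτ.trans h
    calc u ^ 2 - clip τ u ^ 2 ≤ |u| ^ (2 : ℝ) := by
          rw [Real.rpow_two, sq_abs]; linarith [sq_nonneg (clip τ u)]
      _ = |u| ^ κ * |u| ^ (2 - κ) := by
        rw [← Real.rpow_add hu]; simp
      _ ≤ |u| ^ κ * τ ^ (2 - κ) := mul_le_mul_of_nonneg_left
        (Real.rpow_le_rpow_of_nonpos hτ h.le (by linarith)) (by positivity)

end

/-! ### Moments of the truncated noise -/

section

variable {Ω : Type*} [MeasurableSpace Ω] {P : Measure Ω} [IsProbabilityMeasure P] {N : Ω → ℝ}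
  {τ κ σ : ℝ}

lemma integrable_comp_clip (hN : AEMeasurable N P) (hτ : 0 < τ) {f : ℝ → ℝ} (hf : Continuous f) :
    Integrable (fun ω => f (clip τ (N ω))) P := by
  obtain ⟨B, hB⟩ := (isCompact_Icc (a := -τ) (b := τ)).exists_bound_of_continuousOn hf.continuousOn
  exact Integrable.of_bound (C := B)
    (hf.measurable.comp_aemeasurable
      ((measurable_clip τ).comp_aemeasurable hN)).aestronglyMeasurable
    (ae_of_all _ fun ω => hB _ (abs_le.1 (abs_clip_le hτ (N ω))))

lemma integrable_abs_pow_of_integrable_rpow (hN : AEMeasurable N P) (hκ : 3 ≤ κ)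
    (hint : Integrable (fun ω => |N ω| ^ κ) P) {k : ℕ} (hk : k ≤ 3) :
    Integrable (fun ω => |N ω| ^ k) P := by
  refine ((integrable_const 1).add hint).mono'
    ((continuous_abs.pow k).measurable.comp_aemeasurable hN).aestronglyMeasurable
    (ae_of_all _ fun ω => ?_)
  rw [Real.norm_of_nonneg (by positivity)]
  simp only [Pi.add_apply]
  rcases le_or_gt |N ω| 1 with h | h
  · have h1 : |N ω| ^ k ≤ 1 := pow_le_one₀ (abs_nonneg _) h
    have h2 : 0 ≤ |N ω| ^ κ := by positivity
    linarith
  · have h1 : |N ω| ^ k ≤ |N ω| ^ κ := by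
      rw [← Real.rpow_natCast]
      exact Real.rpow_le_rpow_of_exponent_le h.le (le_trans (by exact_mod_cast hk) hκ)
    linarith

lemma abs_integral_clip_le (hN : AEMeasurable N P) (hτ : 0 < τ) (hκ : 3 ≤ κ)
    (hint : Integrable (fun ω => |N ω| ^ κ) P) (hmean : ∫ ω, N ω ∂P = 0) :
    |∫ ω, clip τ (N ω) ∂P| ≤ (∫ ω, |N ω| ^ κ ∂P) * τ ^ (1 - κ) := by
  have hN1 : Integrable N P := by
    have := integrable_abs_pow_of_integrable_rpow hN hκ hint (k := 1) (by norm_num)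
    simp only [pow_one] at this
    exact (integrable_norm_iff hN.aestronglyMeasurable).1 this
  have hc : Integrable (fun ω => clip τ (N ω)) P := integrable_comp_clip hN hτ continuous_id
  have h1 : ∫ ω, clip τ (N ω) ∂P = ∫ ω, (clip τ (N ω) - N ω) ∂P := by
    rw [integral_sub hc hN1, hmean, sub_zero]
  rw [h1, ← integral_mul_const, ← Real.norm_eq_abs]
  exact norm_integral_le_of_norm_le (hint.mul_const _)
    (ae_of_all _ fun ω => abs_clip_sub_le_rpow hτ hκ (N ω))

lemma abs_integral_clip_le_level (hτ : 0 < τ) : |∫ ω, clip τ (N ω) ∂P| ≤ τ := by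
  rw [← Real.norm_eq_abs]
  exact (norm_integral_le_of_norm_le_const (ae_of_all _ fun ω => abs_clip_le hτ (N ω))).trans
    (by simp)

lemma integral_sq_sub_le_integral_clip_sq (hN : AEMeasurable N P) (hτ : 0 < τ) (hκ : 3 ≤ κ)
    (hint : Integrable (fun ω => |N ω| ^ κ) P) :
    ∫ ω, N ω ^ 2 ∂P - (∫ ω, |N ω| ^ κ ∂P) * τ ^ (2 - κ) ≤ ∫ ω, clip τ (N ω) ^ 2 ∂P := by
  have h2 : Integrable (fun ω => N ω ^ 2) P := by
    simpa using integrable_abs_pow_of_integrable_rpow hN hκ hint (k := 2) (by norm_num)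
  have hc : Integrable (fun ω => clip τ (N ω) ^ 2) P :=
    integrable_comp_clip hN hτ (continuous_pow 2)
  have : ∫ ω, (N ω ^ 2 - clip τ (N ω) ^ 2) ∂P ≤ ∫ ω, |N ω| ^ κ * τ ^ (2 - κ) ∂P :=
    integral_mono (h2.sub hc) (hint.mul_const _) fun ω => sq_sub_clip_sq_le_rpow hτ hκ (N ω)
  rw [integral_sub h2 hc, integral_mul_const] at this
  linarith

lemma integral_clip_sq_le (hN : AEMeasurable N P) (hτ : 0 < τ) (hκ : 3 ≤ κ)
    (hint : Integrable (fun ω => |N ω| ^ κ) P) :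
    ∫ ω, clip τ (N ω) ^ 2 ∂P ≤ ∫ ω, N ω ^ 2 ∂P := by
  have h2 : Integrable (fun ω => N ω ^ 2) P := by
    simpa using integrable_abs_pow_of_integrable_rpow hN hκ hint (k := 2) (by norm_num)
  exact integral_mono (integrable_comp_clip hN hτ (continuous_pow 2)) h2 fun ω =>
    sq_le_sq.2 (abs_clip_le_abs hτ _)

lemma integral_abs_clip_sub_mean_pow_three_le (hN : AEMeasurable N P) (hτ : 0 < τ) (hκ : 3 ≤ κ)
    (hint : Integrable (fun ω => |N ω| ^ κ) P) :
    ∫ ω, |clip τ (N ω) - ∫ ω', clip τ (N ω') ∂P| ^ 3 ∂P ≤ 8 * ∫ ω, |N ω| ^ 3 ∂P := by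
  set m := ∫ ω', clip τ (N ω') ∂P with hm
  have hc1 : Integrable (fun ω => |clip τ (N ω)|) P := integrable_comp_clip hN hτ continuous_abs
  have hc3 : Integrable (fun ω => |clip τ (N ω)| ^ 3) P :=
    integrable_comp_clip hN hτ (continuous_abs.pow 3)
  have h3 := integrable_abs_pow_of_integrable_rpow hN hκ hint le_rfl
  have hmono : ∫ ω, |clip τ (N ω)| ^ 3 ∂P ≤ ∫ ω, |N ω| ^ 3 ∂P :=
    integral_mono hc3 h3 fun ω => pow_le_pow_left₀ (abs_nonneg _) (abs_clip_le_abs hτ _) 3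
  have hm1 : |m| ≤ ∫ ω, |clip τ (N ω)| ∂P := abs_integral_le_integral_abs
  -- Jensen's inequality, from the tangent line of the cube at `|m|`
  have hm3 : |m| ^ 3 ≤ ∫ ω, |clip τ (N ω)| ^ 3 ∂P := by
    have : ∫ ω, (3 * |m| ^ 2 * |clip τ (N ω)| - 2 * |m| ^ 3) ∂P
        ≤ ∫ ω, |clip τ (N ω)| ^ 3 ∂P := by
      refine integral_mono ((hc1.const_mul _).sub (integrable_const _)) hc3 fun ω => ?_
      have h0 := abs_nonneg (clip τ (N ω))
      have h0' := abs_nonneg m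
      simp only
      nlinarith [mul_nonneg (add_nonneg h0 (mul_nonneg zero_le_two h0'))
        (sq_nonneg (|clip τ (N ω)| - |m|))]
    rw [integral_sub (hc1.const_mul _) (integrable_const _), integral_const_mul] at this
    simp at this
    have h1 := mul_le_mul_of_nonneg_left hm1 (sq_nonneg m)
    have h2 : |m| ^ 3 = m ^ 2 * |m| := by rw [← sq_abs]; ring
    linarith
  have hle : ∫ ω, |clip τ (N ω) - m| ^ 3 ∂P ≤ ∫ ω, (4 * |clip τ (N ω)| ^ 3 + 4 * |m| ^ 3) ∂P := by
    refine integral_mono (integrable_comp_clip hN hτ (f := fun x => |x - m| ^ 3) (by fun_prop))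
      ((hc3.const_mul 4).add (integrable_const _)) fun ω => ?_
    have h1 : |clip τ (N ω) - m| ≤ |clip τ (N ω)| + |m| := abs_sub _ _
    have h2 := pow_le_pow_left₀ (abs_nonneg _) h1 3
    have h0 := abs_nonneg (clip τ (N ω))
    have h0' := abs_nonneg m
    simp only
    nlinarith [mul_nonneg (add_nonneg h0 h0') (sq_nonneg (|clip τ (N ω)| - |m|))]
  rw [integral_add (hc3.const_mul 4) (integrable_const _), integral_const_mul] at hle
  simp at hle
  linarith

end

/-! ### Normal approximation of truncated sums -/

/-- The comparison of the variance `V = s²` of the truncated noise with `σ²`, as it enters the ratio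
of standard deviations. -/
lemma div_sub_one_le_of_sq {σ s δ : ℝ} (hσ : 0 < σ) (hs : 0 < s) (hδ : σ ^ 2 - 2 * δ ≤ s ^ 2)
    (hhalf : σ ≤ 2 * s) (hle : s ≤ σ) : σ / s - 1 ≤ 4 * (σ⁻¹ ^ 2 * δ) := by
  have h1 : σ / s - 1 = (σ - s) / s := by field_simp
  have h2 : 4 * (σ⁻¹ ^ 2 * δ) = 4 * δ / σ ^ 2 := by field_simp
  rw [h1, h2, div_le_div_iff₀ hs (by positivity)]
  have h3 : (σ - s) * σ ≤ 2 * δ := by nlinarith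
  nlinarith [mul_le_mul_of_nonneg_right h3 hσ.le, mul_nonneg (sub_nonneg.2 hle) hσ.le]

/-- Berry–Esseen for sums of truncated variables, with the truncation bias in mean and variance
absorbed into the error. -/
theorem exists_abs_measureReal_sum_clip_le_sub_cdf_le : ∃ C : ℝ, 0 < C ∧
    ∀ (Ω : Type*) [MeasurableSpace Ω] (P : Measure Ω) [IsProbabilityMeasure P] (n : ℕ)
      (N : Ω → ℝ) (Ns : Fin n → Ω → ℝ) (σ κ τ : ℝ), 0 < n → iIndepFun Ns P →
      (∀ i, IdentDistrib (Ns i) N P P) → ∫ ω, N ω ∂P = 0 → ∫ ω, N ω ^ 2 ∂P = σ ^ 2 → 0 < σ →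
      3 ≤ κ → Integrable (fun ω => |N ω| ^ κ) P → 0 < τ →
      ∀ x, |P.real {ω | ∑ i, clip τ (Ns i ω) ≤ √n * (σ * x)} - cdf (gaussianReal 0 1) x|
        ≤ C * (σ⁻¹ ^ 3 * (∫ ω, |N ω| ^ 3 ∂P) / √n
          + σ⁻¹ ^ 2 * ((∫ ω, |N ω| ^ κ ∂P) * τ ^ (2 - κ))
          + σ⁻¹ * ((∫ ω, |N ω| ^ κ ∂P) * τ ^ (1 - κ)) * √n) := by
  obtain ⟨B, hB, hBE⟩ := exists_abs_measureReal_sum_le_sub_cdf_le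
  refine ⟨64 * B + 4, by positivity, ?_⟩
  have hfinal : ∀ e₁ e₂ e₃ : ℝ, 0 ≤ e₁ → 0 ≤ e₂ → 0 ≤ e₃ →
      64 * B * e₁ + 2 * e₃ + 4 * e₂ ≤ (64 * B + 4) * (e₁ + e₂ + e₃) := by
    intro e₁ e₂ e₃ h₁ h₂ h₃
    linarith [mul_nonneg hB.le h₂, mul_nonneg hB.le h₃]
  intro Ω _ P _ n N Ns σ κ τ hn hindep hident hmean hvar hσ hκ hint hτ x
  have hN : AEMeasurable N P := (hident ⟨0, hn⟩).aemeasurable_snd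
  have hsn : 0 < √(n : ℝ) := Real.sqrt_pos.2 (by exact_mod_cast hn)
  have hsn2 : √(n : ℝ) * √(n : ℝ) = n := Real.mul_self_sqrt n.cast_nonneg
  set v3 := ∫ ω, |N ω| ^ 3 ∂P with hv3
  set vκ := ∫ ω, |N ω| ^ κ ∂P with hvκ
  have hv30 : 0 ≤ v3 := integral_nonneg fun ω => by positivity
  have hvκ0 : 0 ≤ vκ := integral_nonneg fun ω => by positivity
  set δ := vκ * τ ^ (2 - κ) with hδ
  set b := vκ * τ ^ (1 - κ) with hb
  have hδ0 : 0 ≤ δ := by positivity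
  have hb0 : 0 ≤ b := by positivity
  have hδb : δ = τ * b := by
    have : τ ^ (2 - κ) = τ * τ ^ (1 - κ) := by
      rw [← Real.rpow_one_add' hτ.le (by linarith)]; congr 1; ring
    rw [hδ, hb, this]; ring
  set E1 := σ⁻¹ ^ 3 * v3 / √n with hE1
  set E2 := σ⁻¹ ^ 2 * δ with hE2
  set E3 := σ⁻¹ * b * √n with hE3
  have hE10 : 0 ≤ E1 := by positivity
  have hE20 : 0 ≤ E2 := by positivity
  have hE30 : 0 ≤ E3 := by positivity
  rcases le_or_gt (σ ^ 2) (4 * δ) with hbig | hsmall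
  · -- the truncation removes too much variance and the bound is at least one
    have h1 : 1 ≤ 4 * E2 := by
      rw [hE2, inv_pow, inv_mul_eq_div, ← mul_div_assoc, le_div_iff₀ (by positivity)]
      linarith
    have h2 : |P.real {ω | ∑ i, clip τ (Ns i ω) ≤ √n * (σ * x)} - cdf (gaussianReal 0 1) x|
        ≤ 1 := by
      refine abs_le.2 ⟨?_, ?_⟩ <;>
      linarith [cdf_nonneg (gaussianReal 0 1) x, cdf_le_one (gaussianReal 0 1) x,
        measureReal_nonneg (μ := P) (s := {ω | ∑ i, clip τ (Ns i ω) ≤ √n * (σ * x)}),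
        measureReal_le_one (μ := P) (s := {ω | ∑ i, clip τ (Ns i ω) ≤ √n * (σ * x)})]
    linarith [hfinal E1 E2 E3 hE10 hE20 hE30, mul_nonneg hB.le hE10]
  · set m := ∫ ω, clip τ (N ω) ∂P with hm
    have hmb : |m| ≤ b := abs_integral_clip_le hN hτ hκ hint hmean
    have hmδ : m ^ 2 ≤ δ := by
      rw [hδb, ← sq_abs, sq]
      exact mul_le_mul (abs_integral_clip_le_level hτ) hmb (abs_nonneg _) hτ.le
    have hlow := integral_sq_sub_le_integral_clip_sq hN hτ hκ hint
    have hupp := integral_clip_sq_le hN hτ hκ hint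
    rw [hvar] at hlow hupp
    set V := ∫ ω, clip τ (N ω) ^ 2 ∂P - m ^ 2 with hV
    have hVlow : σ ^ 2 - 2 * δ ≤ V := by linarith
    have hVpos : 0 < V := by nlinarith
    set s := √V with hs
    have hs0 : 0 < s := Real.sqrt_pos.2 hVpos
    have hs2 : s ^ 2 = V := Real.sq_sqrt hVpos.le
    have hsσ : s ≤ σ := Real.sqrt_le_iff.2 ⟨hσ.le, by nlinarith [sq_nonneg m]⟩
    have hσs : σ ≤ 2 * s := by
      refine le_of_sq_le_sq ?_ (by positivity)
      nlinarith
    -- the standardised truncated variables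
    set f : ℝ → ℝ := fun u => (clip τ u - m) / s with hf
    have hfm : Measurable f := ((measurable_clip τ).sub_const m).div_const s
    set μ := P.map (fun ω => f (N ω)) with hμ
    have hfN : AEMeasurable (fun ω => f (N ω)) P := hfm.comp_aemeasurable hN
    have : IsProbabilityMeasure μ := Measure.isProbabilityMeasure_map hfN
    have hid : ∀ i, IdentDistrib (fun ω => f (Ns i ω)) (fun ω => f (N ω)) P P := fun i =>
      (hident i).comp hfm
    have hc1 : Integrable (fun ω => clip τ (N ω)) P := integrable_comp_clip hN hτ continuous_id
    have hc2 : Integrable (fun ω => clip τ (N ω) ^ 2) P :=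
      integrable_comp_clip hN hτ (continuous_pow 2)
    have hμ1 : ∫ y, y ∂μ = 0 := by
      rw [hμ, integral_map hfN (by fun_prop)]
      simp only [hf]
      rw [integral_div, integral_sub hc1 (integrable_const m)]
      simp [hm]
    have hμ2 : ∫ y, y ^ 2 ∂μ = 1 := by
      rw [hμ, integral_map hfN (by fun_prop)]
      have : ∀ ω, f (N ω) ^ 2 = (clip τ (N ω) ^ 2 - 2 * m * clip τ (N ω) + m ^ 2) / s ^ 2 := by
        intro ω; simp only [hf]; rw [div_pow]; congr 1; ring
      simp_rw [this]
      have hsub : Integrable (fun ω => clip τ (N ω) ^ 2 - 2 * m * clip τ (N ω)) P :=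
        hc2.sub (hc1.const_mul _)
      rw [integral_div, integral_add hsub (integrable_const _),
        integral_sub hc2 (hc1.const_mul _), integral_const_mul, hs2, div_eq_one_iff_eq hVpos.ne',
        hV, ← hm]
      simp
      ring
    have habs3 : ∀ ω, |f (N ω)| ^ 3 = |clip τ (N ω) - m| ^ 3 / s ^ 3 := by
      intro ω; simp only [hf]; rw [abs_div, div_pow, abs_of_pos hs0]
    have hμ3 : Integrable (fun y => |y| ^ 3) μ := by
      rw [hμ, integrable_map_measure (by fun_prop) hfN]
      exact integrable_comp_clip hN hτ (f := fun c => |(c - m) / s| ^ 3) (by fun_prop)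
    have hμ3' : ∫ y, |y| ^ 3 ∂μ ≤ 64 * (σ⁻¹ ^ 3 * v3) := by
      rw [hμ, integral_map hfN (by fun_prop)]
      simp_rw [habs3]
      rw [integral_div, div_le_iff₀ (by positivity)]
      refine (integral_abs_clip_sub_mean_pow_three_le hN hτ hκ hint).trans ?_
      rw [← hv3]
      have h1 : σ ^ 3 ≤ (2 * s) ^ 3 := pow_le_pow_left₀ hσ.le hσs 3
      calc 8 * v3 = 8 * (σ⁻¹ ^ 3 * v3 * σ ^ 3) := by field_simp
        _ ≤ 8 * (σ⁻¹ ^ 3 * v3 * (2 * s) ^ 3) := by gcongr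
        _ = 64 * (σ⁻¹ ^ 3 * v3) * s ^ 3 := by ring
    set y := (σ * x - √n * m) / s with hy
    have hmain := hBE Ω P n (fun i ω => f (Ns i ω)) μ hn (fun i => (hid i).aemeasurable_fst)
      (fun i => (hid i).map_eq) (hindep.comp (fun _ => f) fun _ => hfm) hμ3 hμ1 hμ2 y
    have hset : {ω | ∑ i, f (Ns i ω) ≤ √n * y} = {ω | ∑ i, clip τ (Ns i ω) ≤ √n * (σ * x)} := by
      ext ω
      simp only [mem_ofPred_eq, hf, hy]
      rw [← Finset.sum_div, ← mul_div_assoc, div_le_div_iff_of_pos_right hs0,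
        Finset.sum_sub_distrib, mul_sub, ← mul_assoc (√(n : ℝ)) (√(n : ℝ)) m, hsn2]
      simp
    rw [hset] at hmain
    have hshift : |cdf (gaussianReal 0 1) y - cdf (gaussianReal 0 1) (σ / s * x)| ≤ 2 * E3 := by
      refine (abs_cdf_gaussianReal_sub_le _ _).trans ?_
      have : y - σ / s * x = -(√n * m / s) := by rw [hy]; ring
      rw [this, abs_neg, abs_div, abs_mul, abs_of_pos hsn, abs_of_pos hs0, div_le_iff₀ hs0]
      calc √n * |m| ≤ √n * b := by gcongr
        _ = σ⁻¹ * b * √n * σ := by field_simp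
        _ ≤ σ⁻¹ * b * √n * (2 * s) := by gcongr
        _ = 2 * E3 * s := by rw [hE3]; ring
    have hdil := abs_cdf_gaussianReal_mul_sub_le ((one_le_div hs0).2 hsσ) x
    have hratio := div_sub_one_le_of_sq hσ hs0 (hVlow.trans hs2.ge) hσs hsσ
    have hBE' : B * ((∫ y, |y| ^ 3 ∂μ) / √n) ≤ 64 * B * E1 := by
      calc _ ≤ B * (64 * (σ⁻¹ ^ 3 * v3) / √n) := by gcongr
        _ = _ := by rw [hE1]; ring
    set p := P.real {ω | ∑ i, clip τ (Ns i ω) ≤ √n * (σ * x)} with hp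
    have htri : |p - cdf (gaussianReal 0 1) x| ≤ 64 * B * E1 + 2 * E3 + 4 * E2 := by
      rw [abs_le] at hmain hshift hdil ⊢
      constructor <;> linarith [hmain.1, hmain.2, hshift.1, hshift.2, hdil.1, hdil.2]
    exact htri.trans (hfinal E1 E2 E3 hE10 hE20 hE30)

/-! ### The heteroscedastic linear model -/

/-- The noise as a function of the observed pair of response and covariate. -/
noncomputable def residual {d : ℕ} (μ : ℝ) (β : EuclideanSpace ℝ (Fin d))
    (p : ℝ × EuclideanSpace ℝ (Fin d)) : ℝ :=
  p.1 - μ - inner ℝ p.2 β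

lemma measurable_residual {d : ℕ} (μ : ℝ) (β : EuclideanSpace ℝ (Fin d)) :
    Measurable (residual μ β) := by
  unfold residual
  fun_prop

lemma residual_comp_response {Ω : Type*} {d : ℕ} (μ : ℝ) (β : EuclideanSpace ℝ (Fin d))
    (s : EuclideanSpace ℝ (Fin d) → ℝ) (X : Ω → EuclideanSpace ℝ (Fin d)) (ε : Ω → ℝ) :
    (fun ω => residual μ β (response μ β s X ε ω, X ω)) = noise s X ε := by
  ext ω
  simp only [residual, response, noise]
  ring

lemma inv_mul_scoreSum_le_iff {Ω : Type*} {n : ℕ} (hn : 0 < n) {σ τ : ℝ} (hσ : 0 < σ) (hτ : 0 < τ)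
    (νs : Fin n → Ω → ℝ) (ω : Ω) (x : ℝ) :
    σ⁻¹ * scoreSum τ νs ω ≤ x ↔ ∑ i, clip τ (νs i ω) ≤ √n * (σ * x) := by
  have hsn : 0 < √(n : ℝ) := Real.sqrt_pos.2 (by exact_mod_cast hn)
  have hpow : (n : ℝ) ^ (-(1 / 2) : ℝ) = (√n)⁻¹ := by
    rw [Real.rpow_neg n.cast_nonneg, Real.sqrt_eq_rpow]
  simp only [scoreSum, deriv_huberLoss hτ]
  rw [hpow, inv_mul_le_iff₀ hσ, inv_mul_le_iff₀ hsn]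

section

variable {Ω : Type*} [MeasurableSpace Ω] {P : Measure Ω} {d n : ℕ}
  {μ : ℝ} {β : EuclideanSpace ℝ (Fin d)} {s : EuclideanSpace ℝ (Fin d) → ℝ}
  {X : Ω → EuclideanSpace ℝ (Fin d)} {ε : Ω → ℝ}
  {Xs : Fin n → Ω → EuclideanSpace ℝ (Fin d)} {εs : Fin n → Ω → ℝ}

lemma iIndepFun_noise (h : IsModelSample P μ β s X ε Xs εs) :
    iIndepFun (fun i => noise s (Xs i) (εs i)) P := by
  have := h.indep.comp (fun _ => residual μ β) fun _ => measurable_residual μ β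
  convert this using 2 with i
  exact (residual_comp_response μ β s (Xs i) (εs i)).symm

lemma identDistrib_noise (h : IsModelSample P μ β s X ε Xs εs) (i : Fin n) :
    IdentDistrib (noise s (Xs i) (εs i)) (noise s X ε) P P := by
  rw [← residual_comp_response μ β s (Xs i), ← residual_comp_response μ β s X]
  exact (h.ident i).comp (measurable_residual μ β)

lemma integral_noise (h : ModelCondition P X ε s) : ∫ ω, noise s X ε ω ∂P = 0 := by
  have hi : IndepFun (fun ω => s (X ω)) ε P := (h.indep.comp measurable_id h.measurable_s).symm
  have := hi.integral_fun_mul_eq_mul_integral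
    (h.measurable_s.comp_aemeasurable h.memLp_X.aemeasurable).aestronglyMeasurable
    h.memLp_ε.aestronglyMeasurable
  simp only [noise]
  rw [this, h.mean_ε, mul_zero]

lemma noiseScale_sq (P : Measure Ω) (s : EuclideanSpace ℝ (Fin d) → ℝ)
    (X : Ω → EuclideanSpace ℝ (Fin d)) : noiseScale P s X ^ 2 = ∫ ω, s (X ω) ^ 2 ∂P :=
  Real.sq_sqrt (integral_nonneg fun _ => sq_nonneg _)

lemma integral_noise_sq (h : ModelCondition P X ε s) :
    ∫ ω, noise s X ε ω ^ 2 ∂P = noiseScale P s X ^ 2 := by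
  have hi : IndepFun (fun ω => s (X ω) ^ 2) (fun ω => ε ω ^ 2) P :=
    (h.indep.comp (measurable_id.pow_const 2) (h.measurable_s.pow_const 2)).symm
  have := hi.integral_fun_mul_eq_mul_integral h.integrable_s.aestronglyMeasurable
    (h.memLp_ε.aestronglyMeasurable.pow 2)
  simp only [noise, mul_pow]
  rw [this, h.var_ε, mul_one, noiseScale_sq]

lemma noiseScale_pos [IsProbabilityMeasure P] (h : ModelCondition P X ε s) :
    0 < noiseScale P s X := by
  refine Real.sqrt_pos.2 ((integral_pos_iff_support_of_nonneg (fun ω => sq_nonneg _)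
    h.integrable_s).2 ?_)
  have : Function.support (fun ω => s (X ω) ^ 2) = univ := by
    ext ω
    simpa using (h.pos_s (X ω)).ne'
  rw [this]
  simp

end

end BerryEsseen

open BerryEsseen in
theorem theorem2p2 :
    ∃ C : ℝ, 0 < C ∧
      ∀ (Ω : Type*) [MeasurableSpace Ω] (P : Measure Ω) [IsProbabilityMeasure P] (d n : ℕ)
        (μ : ℝ) (β : EuclideanSpace ℝ (Fin d)) (s : EuclideanSpace ℝ (Fin d) → ℝ)
        (X : Ω → EuclideanSpace ℝ (Fin d)) (ε : Ω → ℝ)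
        (Xs : Fin n → Ω → EuclideanSpace ℝ (Fin d)) (εs : Fin n → Ω → ℝ) (σ : ℝ) (v : ℝ → ℝ),
        0 < n →
        ModelCondition P X ε s →
        IsModelSample P μ β s X ε Xs εs →
        σ = noiseScale P s X →
        v = absMoment P (noise s X ε) →
        (∀ κ : ℝ, 3 ≤ κ → Integrable (fun ω => |noise s X ε ω| ^ κ) P →
          ∀ τ : ℝ, 0 < τ →
            distToNormal P (fun ω => σ⁻¹ * scoreSum τ (fun i => noise s (Xs i) (εs i)) ω) ≤
              C * (σ ^ (-3 : ℝ) * v 3 * (n : ℝ) ^ (-(1 / 2) : ℝ)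
                + σ ^ (-2 : ℝ) * v κ * τ ^ (2 - κ)
                + σ ^ 2 * τ ^ (-2 : ℝ)
                + σ⁻¹ * v κ * τ ^ (1 - κ) * Real.sqrt n)) ∧
        (Integrable (fun ω => |noise s X ε ω| ^ (4 : ℝ)) P →
          ∀ τ : ℝ, 0 < τ →
            distToNormal P (fun ω => σ⁻¹ * scoreSum τ (fun i => noise s (Xs i) (εs i)) ω) ≤
              C * (σ ^ (-3 : ℝ) * v 3 * (n : ℝ) ^ (-(1 / 2) : ℝ)
                + σ ^ (-2 : ℝ) * v 4 * τ ^ (-2 : ℝ)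
                + σ⁻¹ * v 4 * τ ^ (-3 : ℝ) * Real.sqrt n)) := by
  obtain ⟨C, hC, hclip⟩ := exists_abs_measureReal_sum_clip_le_sub_cdf_le
  refine ⟨C, hC, ?_⟩
  intro Ω _ P _ d n μ β s X ε Xs εs σ v hn hmodel hsample hσ hv
  have hσ0 : 0 < σ := hσ ▸ noiseScale_pos hmodel
  have hvar : ∫ ω, noise s X ε ω ^ 2 ∂P = σ ^ 2 := hσ ▸ integral_noise_sq hmodel
  -- the bound without the term `σ² / τ²` implies both claims
  have key : ∀ κ : ℝ, 3 ≤ κ → Integrable (fun ω => |noise s X ε ω| ^ κ) P → ∀ τ : ℝ, 0 < τ →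
      distToNormal P (fun ω => σ⁻¹ * scoreSum τ (fun i => noise s (Xs i) (εs i)) ω) ≤
        C * (σ ^ (-3 : ℝ) * v 3 * (n : ℝ) ^ (-(1 / 2) : ℝ)
          + σ ^ (-2 : ℝ) * v κ * τ ^ (2 - κ)
          + σ⁻¹ * v κ * τ ^ (1 - κ) * Real.sqrt n) := by
    intro κ hκ hint τ hτ
    refine ciSup_le fun x => ?_
    simp_rw [inv_mul_scoreSum_le_iff hn hσ0 hτ]
    refine (hclip Ω P n (noise s X ε) _ σ κ τ hn (iIndepFun_noise hsample)
      (identDistrib_noise hsample) (integral_noise hmodel) hvar hσ0 hκ hint hτ x).trans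
      (le_of_eq ?_)
    have h3 : v 3 = ∫ ω, |noise s X ε ω| ^ 3 ∂P := by
      simp only [hv, absMoment]
      congr 1 with ω
      exact_mod_cast Real.rpow_natCast |noise s X ε ω| 3
    have hσ3 : σ ^ (-3 : ℝ) = σ⁻¹ ^ 3 := by
      rw [Real.rpow_neg hσ0.le, inv_pow]
      exact_mod_cast congrArg _ (Real.rpow_natCast σ 3)
    have hσ2 : σ ^ (-2 : ℝ) = σ⁻¹ ^ 2 := by
      rw [Real.rpow_neg hσ0.le, Real.rpow_two, inv_pow]
    have hpow : (n : ℝ) ^ (-(1 / 2) : ℝ) = (√n)⁻¹ := by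
      rw [Real.rpow_neg n.cast_nonneg, Real.sqrt_eq_rpow]
    have hvκ : v κ = ∫ ω, |noise s X ε ω| ^ κ ∂P := by rw [hv]; rfl
    rw [h3, hσ3, hσ2, hpow, ← hvκ]
    ring
  refine ⟨fun κ hκ hint τ hτ => (key κ hκ hint τ hτ).trans ?_, fun hint τ hτ => ?_⟩
  · refine mul_le_mul_of_nonneg_left ?_ hC.le
    have : 0 ≤ σ ^ 2 * τ ^ (-2 : ℝ) := by positivity
    linarith
  · have := key 4 (by norm_num) hint τ hτ
    norm_num at this ⊢
    exact this
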